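/- All manifolds are smooth, Hausdorff and paracompact, of finite dimension without boundary; $\mathcal F(M)=C^\infty(M)$, and all bundles, sections and maps are smooth. **Generalized Lie algebroid.** Let $F\to N$ be a vector bundle of rank $p$, let $h\colon M\to N$ and $\eta\colon N\to M$ be diffeomorphisms, and let $(\rho,\eta)$ be a vector bundle morphism from $F\to N$ to $TM\to M$. For $u\in\Gamma(F)$ let $\Gamma(Th\circ\rho,h\circ\eta)(u)=(Th\circ\rho)\circ u\circ(h\circ\eta)^{-1}$, a vector field on $N$. A generalized Lie algebroid $((F,\nu,N),[\,,]_{F,h},(\rho,\eta))$ is given by these data together with a biadditive operation $[\,,]_{F,h}$ on $\Gamma(F)$ with $[u,u]_{F,h}=0$, satisfying the Jacobi identity and $$[u,fv]_{F,h}=f[u,v]_{F,h}+\Gamma(Th\circ\rho,h\circ\eta)(u)(f)\,v\qquad(u,v\in\Gamma(F),\ f\in\mathcal F(N)).$$ Its pull-back Lie algebroid is the vector bundle $h^*F\to M$ with the bracket and the anchor determined by $[u\circ h,v\circ h]_{h^*F}=[u,v]_{F,h}\circ h$ and $(u\circ h)(f\circ h)=\big(\Gamma(Th\circ\rho,h\circ\eta)(u)(f)\big)\circ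 h$. For $U\subseteq M$ open it restricts to a bracket on $\Gamma(h^*F|_U)$ and an action of $\Gamma(h^*F|_U)$ on $\mathcal F(U)$ by derivations. **Exterior calculus.** For $U\subseteq M$ open, $\Lambda^q(h^*F|_U)$ is the module of alternating $\mathcal F(U)$-multilinear maps $\Gamma(h^*F|_U)^q\to\mathcal F(U)$; $\Lambda(h^*F|_U)=\bigoplus_{q\ge0}\Lambda^q(h^*F|_U)$, with the wedge product, is the exterior algebra, with the differential $$d\omega(z_0,\dots,z_q)=\sum_{i}(-1)^i z_i\big(\omega(z_0,\dots,\widehat{z_i},\dots,z_q)\big)+\sum_{i<j}(-1)^{i+j}\omega([z_i,z_j]_{h^*F},z_0,\dots,\widehat{z_i},\dots,\widehat{z_j},\dots,z_q).$$ A differential ideal is an ideal $\mathcal I$ of $\Lambda(h^*F|_U)$ with $d\mathcal I\subseteq\mathcal I$. **Systems.** An interior differential system (IDS) is a vector subbundle $E$ of $h^*F\to M$ (its rank may differ on different components of $M$). It is involutive if $[S,T]_{h^*F}\in\Gamma(E)$ for all $S,T\in\Gamma(E)$. The sections over $U$ of its annihilator bundle are $\Gamma(E^0|_U)=\{\Theta\in\Lambda^1(h^*F|_U):\Theta(S)=0\text{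 for all }S\in\Gamma(E|_U)\}$. A differential ideal $\mathcal I$ of $\Lambda(h^*F|_U)$ is an exterior differential system (EDS) over $U$ if there is an IDS $E'$ such that, for all $k\ge1$ and $\omega\in\mathcal I\cap\Lambda^k(h^*F|_U)$, one has $\omega(u_1,\dots,u_k)=0$ for all $u_1,\dots,u_k\in\Gamma(E'|_U)$. **Corollary.** Let $E$ be an IDS of a generalized Lie algebroid, and let $\mathcal A$ be an atlas of $M$, consisting of charts $(U,\xi_U)$ of its smooth structure over whose domains $h^*F$ is trivial. Then $E$ is involutive if and only if, for every $(U,\xi_U)\in\mathcal A$, the ideal of $\Lambda(h^*F|_U)$ generated by $\Gamma(E^0|_U)$ is an EDS over $U$ (in particular it is closed under $d$). -/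

import Mathlib

set_option linter.unusedSectionVars false

/-- A generalized Lie algebra over a commutative ring `R` of functions: an `R`-module with a
biadditive alternating bracket satisfying the Jacobi identity, and a module morphism to the
(additive) derivations of `R` for which the Leibniz rule holds. -/
structure GenLieAlgebra (R A : Type*) [CommRing R] [AddCommGroup A] [Module R A] where
  anchor : A →ₗ[R] Derivation ℤ R R
  bracket : A → A → A
  add_bracket : ∀ u v w, bracket (u + v) w = bracket u w + bracket v w
  bracket_add : ∀ u v w, bracket u (v + w) = bracket u v + bracket u w
  bracket_self : ∀ u, bracket u u = 0
  jacobi : ∀ u v w, bracket u (bracket v w) + bracket w (bracket u v) + bracket v (bracket w u) = 0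
  leibniz : ∀ (u : A) (f : R) (v : A), bracket u (f • v) = f • bracket u v + anchor u f • v

namespace GenLieAlgebra

variable {R A : Type*} [CommRing R] [AddCommGroup A] [Module R A]

theorem bracket_swap (L : GenLieAlgebra R A) (u v : A) : L.bracket u v = -L.bracket v u := by
  have h := L.bracket_self (u + v)
  rw [L.add_bracket, L.bracket_add, L.bracket_add, L.bracket_self, L.bracket_self, zero_add,
    add_zero] at h
  exact eq_neg_of_add_eq_zero_left h

theorem smul_bracket (L : GenLieAlgebra R A) (f : R) (u v : A) :
    L.bracket (f • u) v = f • L.bracket u v - L.anchor v f • u := by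
  rw [L.bracket_swap, L.leibniz, L.bracket_swap u v, smul_neg]
  abel

/-- The terms of the exterior derivative which contain the anchor. -/
def koszulAnchor (L : GenLieAlgebra R A) {q : ℕ} (ω : A [⋀^Fin q]→ₗ[R] R)
    (z : Fin (q + 1) → A) : R :=
  ∑ i : Fin (q + 1), (-1) ^ (i : ℕ) * L.anchor (z i) (ω (i.removeNth z))

/-- The terms of the exterior derivative which contain the bracket. The summand `(i, j)` belongs to
the pair of positions `i < j + 1` of `z`. -/
def koszulBracket (L : GenLieAlgebra R A) :
    {q : ℕ} → (A [⋀^Fin q]→ₗ[R] R) → (Fin (q + 1) → A) → R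
  | 0, _, _ => 0
  | q + 1, ω, z => ∑ i : Fin (q + 1), ∑ j ∈ Finset.Ici i, (-1) ^ ((i : ℕ) + ((j : ℕ) + 1)) *
      ω (Matrix.vecCons (L.bracket (z i.castSucc) (z j.succ))
        (j.removeNth (i.castSucc.removeNth z)))

/-- The formula for the exterior derivative of `ω`, evaluated on `z 0, …, z q`:
`∑ i, (-1)^i ρ(z i)(ω(…, ẑ i, …)) + ∑ i < j, (-1)^(i+j) ω([z i, z j], …, ẑ i, …, ẑ j, …)`. -/
def koszul (L : GenLieAlgebra R A) {q : ℕ} (ω : A [⋀^Fin q]→ₗ[R] R)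
    (z : Fin (q + 1) → A) : R :=
  L.koszulAnchor ω z + L.koszulBracket ω z

theorem removeNth_succ_cons {X : Type*} {q : ℕ} (a : X) (z : Fin (q + 1) → X)
    (i : Fin (q + 1)) :
    i.succ.removeNth (Fin.cons a z : Fin (q + 2) → X) = Fin.cons a (i.removeNth z) := by
  funext k
  refine Fin.cases ?_ (fun k => ?_) k <;> simp [Fin.removeNth]

theorem map_update_eq {q : ℕ} (ω : A [⋀^Fin (q + 1)]→ₗ[R] R) (z : Fin (q + 1) → A)
    (j : Fin (q + 1)) (x : A) :
    ω (Function.update z j x) = (-1) ^ (j : ℕ) * ω (Fin.cons x (j.removeNth z)) := by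
  have := ω.map_insertNth j x (j.removeNth z)
  rw [Fin.insertNth_removeNth] at this
  rw [this]
  simp [Matrix.vecCons]

theorem koszulAnchor_cons (L : GenLieAlgebra R A) {q : ℕ} (ω : A [⋀^Fin (q + 1)]→ₗ[R] R)
    (a : A) (z : Fin (q + 1) → A) :
    L.koszulAnchor ω (Fin.cons a z : Fin (q + 2) → A) =
      L.anchor a (ω z) - L.koszulAnchor (ω.curryLeft a) z := by
  rw [koszulAnchor, Fin.sum_univ_succ, koszulAnchor, sub_eq_add_neg, ← Finset.sum_neg_distrib]
  congr 1
  · simp [Fin.removeNth_zero]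
  · refine Finset.sum_congr rfl fun i _ => ?_
    rw [removeNth_succ_cons]
    simp [pow_succ, Matrix.vecCons]

theorem koszulBracket_cons (L : GenLieAlgebra R A) : ∀ {q : ℕ} (ω : A [⋀^Fin (q + 1)]→ₗ[R] R)
    (a : A) (z : Fin (q + 1) → A),
    L.koszulBracket ω (Fin.cons a z : Fin (q + 2) → A) =
      -∑ j, ω (Function.update z j (L.bracket a (z j))) - L.koszulBracket (ω.curryLeft a) z := by
  have key : ∀ {q : ℕ} (ω : A [⋀^Fin (q + 1)]→ₗ[R] R) (a : A) (z : Fin (q + 1) → A),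
      ∑ j ∈ Finset.Ici (0 : Fin (q + 1)), (-1) ^ (((0 : Fin (q + 1)) : ℕ) + ((j : ℕ) + 1)) *
      ω (Matrix.vecCons (L.bracket ((Fin.cons a z : Fin (q + 2) → A) (Fin.castSucc 0))
        ((Fin.cons a z : Fin (q + 2) → A) j.succ))
        (j.removeNth ((Fin.castSucc 0).removeNth (Fin.cons a z : Fin (q + 2) → A)))) =
      -∑ j, ω (Function.update z j (L.bracket a (z j))) := by
    intro q ω a z
    rw [← Finset.sum_neg_distrib]
    have : Finset.Ici (0 : Fin (q + 1)) = Finset.univ := by ext; simp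
    rw [this]
    refine Finset.sum_congr rfl fun j _ => ?_
    rw [map_update_eq]
    simp [pow_succ, Matrix.vecCons, Fin.removeNth_zero]
  intro q ω a z
  cases q with
  | zero =>
    have h := key ω a z
    have h0 : L.koszulBracket (ω.curryLeft a) z = 0 := rfl
    rw [h0, sub_zero]
    exact Eq.trans (Fin.sum_univ_one _) h
  | succ q =>
    rw [koszulBracket, Fin.sum_univ_succ, key, koszulBracket, sub_eq_add_neg]
    congr 1
    rw [← Finset.sum_neg_distrib]
    refine Finset.sum_congr rfl fun i _ => ?_
    rw [← Finset.sum_neg_distrib]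
    have : Finset.Ici i.succ = (Finset.Ici i).map (Fin.succEmb _) := by
      simp
    rw [this, Finset.sum_map]
    refine Finset.sum_congr rfl fun j _ => ?_
    have hsw : ∀ (x : A) (w : Fin q → A),
        ω (Fin.cons x (Fin.cons a w : Fin (q + 1) → A) : Fin (q + 2) → A) =
        - ω (Fin.cons a (Fin.cons x w : Fin (q + 1) → A) : Fin (q + 2) → A) := by
      intro x w
      rw [← ω.map_swap _ (show (0 : Fin (q + 2)) ≠ 1 by simp)]
      congr 1
      funext k
      refine Fin.cases ?_ (fun k => Fin.cases ?_ (fun k => ?_) k) k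
      · simp
      · simp
      · have h0 : (k.succ.succ : Fin (q + 2)) ≠ 0 := Fin.succ_ne_zero _
        have h1 : (k.succ.succ : Fin (q + 2)) ≠ 1 := by
          rw [← Fin.succ_zero_eq_one]; exact fun h => Fin.succ_ne_zero _ (Fin.succ_injective _ h)
        simp [Equiv.swap_apply_of_ne_of_ne h0 h1]
    simp only [Fin.castSucc_succ, removeNth_succ_cons, Fin.cons_succ, Fin.coe_succEmb,
      Matrix.vecCons, AlternatingMap.curryLeft_apply_apply, Fin.val_succ]
    rw [hsw]
    ring

theorem koszul_cons (L : GenLieAlgebra R A) {q : ℕ} (ω : A [⋀^Fin (q + 1)]→ₗ[R] R)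
    (a : A) (z : Fin (q + 1) → A) :
    L.koszul ω (Fin.cons a z : Fin (q + 2) → A) =
      L.anchor a (ω z) - ∑ j, ω (Function.update z j (L.bracket a (z j))) -
        L.koszul (ω.curryLeft a) z := by
  rw [koszul, koszulAnchor_cons, koszulBracket_cons, koszul]
  ring

theorem koszul_add (L : GenLieAlgebra R A) {q : ℕ} (ω θ : A [⋀^Fin q]→ₗ[R] R)
    (z : Fin (q + 1) → A) : L.koszul (ω + θ) z = L.koszul ω z + L.koszul θ z := by
  cases q <;> simp only [koszul, koszulAnchor, koszulBracket, AlternatingMap.add_apply, map_add,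
    mul_add, Finset.sum_add_distrib] <;> ring

theorem koszul_smul (L : GenLieAlgebra R A) {q : ℕ} (f : R) (ω : A [⋀^Fin q]→ₗ[R] R)
    (z : Fin (q + 1) → A) : L.koszul (f • ω) z = f * L.koszul ω z +
      ∑ i : Fin (q + 1), (-1) ^ (i : ℕ) * (L.anchor (z i) f * ω (i.removeNth z)) := by
  cases q <;> simp only [koszul, koszulAnchor, koszulBracket, AlternatingMap.smul_apply,
    smul_eq_mul, Derivation.leibniz, mul_add, Finset.sum_add_distrib, Finset.mul_sum,
    mul_left_comm f, mul_comm (ω _) (L.anchor _ _)] <;> ring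


theorem exists_koszul (L : GenLieAlgebra R A) : ∀ {q : ℕ} (ω : A [⋀^Fin q]→ₗ[R] R),
    ∃ D : A [⋀^Fin (q + 1)]→ₗ[R] R, ∀ z, D z = L.koszul ω z := by
  intro q
  induction q with
  | zero =>
    intro ω
    refine ⟨AlternatingMap.ofSubsingleton R A R (0 : Fin 1)
      { toFun := fun a => L.anchor a (ω ![])
        map_add' := fun a b => by simp
        map_smul' := fun f a => by simp }, fun z => ?_⟩
    have : (0 : Fin 1).removeNth z = ![] := Subsingleton.elim _ _
    simp [koszul, koszulAnchor, koszulBracket, this]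
  | succ q ih =>
    intro ω
    choose D hD using @ih
    -- evaluation with separated first argument
    have hc : ∀ z : Fin (q + 2) → A, L.koszul ω z = L.anchor (z 0) (ω (Fin.tail z)) -
        ∑ j, ω (Function.update (Fin.tail z) j (L.bracket (z 0) (Fin.tail z j))) -
          D (ω.curryLeft (z 0)) (Fin.tail z) := by
      intro z
      rw [hD, ← koszul_cons, Fin.cons_self_tail]
    have hDadd : ∀ (θ₁ θ₂ : A [⋀^Fin q]→ₗ[R] R) z, D (θ₁ + θ₂) z = D θ₁ z + D θ₂ z := by
      intro θ₁ θ₂ z; simp only [hD, koszul_add]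
    have hmul : ∃ Dm : MultilinearMap R (fun _ : Fin (q + 2) => A) R, ∀ z, Dm z = L.koszul ω z := by
      refine ⟨MultilinearMap.mk' (L.koszul ω) ?_ ?_, fun _ => rfl⟩
      · intro z k x y
        refine Fin.cases ?_ (fun k => ?_) k
        · simp only [hc, Fin.tail_update_zero, Function.update_self, map_add, hDadd,
            L.add_bracket, AlternatingMap.map_update_add, Finset.sum_add_distrib,
            Derivation.add_apply]
          ring
        · have h0 : ∀ x : A, Function.update z k.succ x 0 = z 0 := fun x =>
            Function.update_of_ne (Fin.succ_ne_zero k).symm _ _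
          have key : ∀ j, ω (Function.update (Function.update (Fin.tail z) k (x + y)) j
              (L.bracket (z 0) (Function.update (Fin.tail z) k (x + y) j))) =
              ω (Function.update (Function.update (Fin.tail z) k x) j
              (L.bracket (z 0) (Function.update (Fin.tail z) k x j))) +
              ω (Function.update (Function.update (Fin.tail z) k y) j
              (L.bracket (z 0) (Function.update (Fin.tail z) k y j))) := by
            intro j
            rcases eq_or_ne j k with rfl | hjk
            · simp [L.bracket_add]
            · simp [Function.update_of_ne hjk, Function.update_comm hjk.symm]
          simp only [hc, Fin.tail_update_succ, h0, key, AlternatingMap.map_update_add, map_add,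
            Finset.sum_add_distrib]
          ring
      · intro z k f x
        refine Fin.cases ?_ (fun k => ?_) k
        · have hs : ∀ z', D (f • ω.curryLeft x) z' = f * D (ω.curryLeft x) z' +
              ∑ j : Fin (q + 1), L.anchor (z' j) f * ω (Function.update z' j x) := by
            intro z'
            rw [hD, koszul_smul, hD]
            congr 1
            refine Finset.sum_congr rfl fun j _ => ?_
            rw [map_update_eq]
            simp only [AlternatingMap.curryLeft_apply_apply, Matrix.vecCons]
            ring
          simp only [hc, Fin.tail_update_zero, Function.update_self, map_smul, hs, L.smul_bracket,
            AlternatingMap.map_update_sub, AlternatingMap.map_update_smul,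
            Finset.sum_sub_distrib, Derivation.smul_apply, smul_eq_mul, mul_sub, Finset.mul_sum]
          ring
        · have h0 : ∀ x : A, Function.update z k.succ x 0 = z 0 := fun x =>
            Function.update_of_ne (Fin.succ_ne_zero k).symm _ _
          have key : ∀ j, ω (Function.update (Function.update (Fin.tail z) k (f • x)) j
              (L.bracket (z 0) (Function.update (Fin.tail z) k (f • x) j))) =
              f * ω (Function.update (Function.update (Fin.tail z) k x) j
              (L.bracket (z 0) (Function.update (Fin.tail z) k x j))) +
              if j = k then L.anchor (z 0) f * ω (Function.update (Fin.tail z) k x) else 0 := by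
            intro j
            rcases eq_or_ne j k with rfl | hjk
            · simp [L.leibniz]
            · simp [Function.update_comm hjk.symm, hjk]
          simp only [hc, Fin.tail_update_succ, h0, key, AlternatingMap.map_update_smul,
            Finset.sum_add_distrib, Finset.sum_ite_eq', Finset.mem_univ, if_true, smul_eq_mul,
            Derivation.leibniz, mul_sub, Finset.mul_sum]
          ring
    obtain ⟨Dm, hDm⟩ := hmul
    -- alternation among the positions `≥ 1`
    have alt1 : ∀ (z : Fin (q + 2) → A) (k l : Fin (q + 1)), k ≠ l → z k.succ = z l.succ →
        Dm z = 0 := by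
      intro z k l hkl hz
      have hz' : Fin.tail z k = Fin.tail z l := hz
      rw [hDm, hc, ω.map_eq_zero_of_eq _ hz' hkl, (D _).map_eq_zero_of_eq _ hz' hkl, map_zero,
        sub_zero, zero_sub, neg_eq_zero]
      rw [Finset.sum_eq_add k l hkl]
      · rw [← hz', add_comm]
        have : Function.update (Fin.tail z) k (L.bracket (z 0) (Fin.tail z k)) =
            Function.update (Fin.tail z) l (L.bracket (z 0) (Fin.tail z k)) ∘ Equiv.swap k l := by
          funext i
          rcases eq_or_ne i k with rfl | hik
          · simp
          rcases eq_or_ne i l with rfl | hil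
          · simp [Function.update_of_ne hik, Function.update_of_ne hkl, hz']
          · simp [Equiv.swap_apply_of_ne_of_ne hik hil, hik, hil]
        rw [this, ω.map_swap _ hkl]
        ring
      · intro j _ ⟨hjk, hjl⟩
        refine ω.map_eq_zero_of_eq _ (i := k) (j := l) ?_ hkl
        rw [Function.update_of_ne hjk.symm, Function.update_of_ne hjl.symm, hz']
      · simp
      · simp
    -- positions `0` and `1`
    have alt2 : ∀ (z : Fin (q + 2) → A), z 0 = z 1 → Dm z = 0 := by
      intro z hz
      have hdec : Fin.tail z = Fin.cons (z 0) (Fin.tail (Fin.tail z)) := by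
        rw [hz]; exact (Fin.cons_self_tail (Fin.tail z)).symm
      rw [hDm, ← Fin.cons_self_tail z, koszul_cons, hdec]
      generalize Fin.tail (Fin.tail z) = w
      generalize z 0 = a
      clear hdec hz hc
      rw [Fin.sum_univ_succ]
      simp only [Fin.cons_zero, Fin.cons_succ, L.bracket_self, Fin.update_cons_zero,
        ← Fin.cons_update]
      have h1 : ω (Fin.cons 0 w) = 0 := ω.map_coord_zero 0 (by simp)
      rw [h1, zero_add]
      cases q with
      | zero =>
        have : (0 : Fin 1).removeNth (Fin.cons a w : Fin 1 → A) = w := Subsingleton.elim _ _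
        simp [koszul, koszulAnchor, koszulBracket, this, Matrix.vecCons]
      | succ q =>
        rw [koszul_cons]
        have h2 : (ω.curryLeft a).curryLeft a = 0 := ω.curryLeft_same a
        have h3 : L.koszul (0 : A [⋀^Fin q]→ₗ[R] R) w = 0 := by
          have := L.koszul_add (0 : A [⋀^Fin q]→ₗ[R] R) 0 w
          simpa using this
        rw [h2, h3]
        simp [Matrix.vecCons]
    -- positions `0` and `k + 1`
    have alt3 : ∀ (z : Fin (q + 2) → A) (k : Fin (q + 1)), z 0 = z k.succ → Dm z = 0 := by
      intro z k hz
      rcases eq_or_ne k 0 with rfl | hk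
      · exact alt2 z hz
      let N : A [⋀^Fin (q + 1)]→ₗ[R] R :=
        { Dm.curryLeft (z 0) with
          map_eq_zero_of_eq' := fun w i j hw hij =>
            alt1 (Fin.cons (z 0) w) i j hij (by simpa using hw) }
      have hN : ∀ w, N w = Dm (Fin.cons (z 0) w) := fun w => rfl
      have h1 : Dm z = N (Fin.tail z) := by rw [hN, Fin.cons_self_tail]
      have h2 := N.map_swap (Fin.tail z) hk
      have h3 : N (Fin.tail z ∘ Equiv.swap k 0) = 0 := by
        rw [hN]
        refine alt2 _ ?_
        have : (1 : Fin (q + 2)) = Fin.succ 0 := rfl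
        rw [this]
        simp [Fin.tail, hz]
      rw [h1, ← neg_eq_zero, ← h2, h3]
    refine ⟨{ Dm with map_eq_zero_of_eq' := ?_ }, hDm⟩
    intro z i j
    refine Fin.cases ?_ (fun i => ?_) i <;> refine Fin.cases ?_ (fun j => ?_) j
    · intro _ h; exact absurd rfl h
    · intro h _; exact alt3 z j h
    · intro h _; exact alt3 z i h.symm
    · intro h hij; exact alt1 z i j (fun h' => hij (by rw [h'])) h

end GenLieAlgebra

namespace GenLieAlgebra

variable {R A : Type*} [CommRing R] [AddCommGroup A] [Module R A]

/-- The exterior derivative of a `q`-form. -/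
def extDer (L : GenLieAlgebra R A) {q : ℕ} (ω : A [⋀^Fin q]→ₗ[R] R) :
    A [⋀^Fin (q + 1)]→ₗ[R] R where
  toFun z := L.koszul ω z
  map_update_add' z k x y := by
    obtain ⟨D, hD⟩ := L.exists_koszul ω
    simp only [← hD]
    exact D.toMultilinearMap.map_update_add' z k x y
  map_update_smul' z k f x := by
    obtain ⟨D, hD⟩ := L.exists_koszul ω
    simp only [← hD]
    exact D.toMultilinearMap.map_update_smul' z k f x
  map_eq_zero_of_eq' z i j h hij := by
    obtain ⟨D, hD⟩ := L.exists_koszul ω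
    simp only [← hD]
    exact D.map_eq_zero_of_eq z h hij

end GenLieAlgebra

section Forms

variable (R A : Type*) [CommRing R] [AddCommGroup A] [Module R A]

/-- The exterior algebra: the direct sum of the modules of alternating `q`-forms on `A`. -/
abbrev ExtForms : Type _ := DirectSum ℕ fun q => A [⋀^Fin q]→ₗ[R] R

variable {R A}

/-- The wedge product of a `q`-form and an `r`-form, the sum over shuffles of signed products. -/
def wedgeForm (q r : ℕ) :
    (A [⋀^Fin q]→ₗ[R] R) →ₗ[R] (A [⋀^Fin r]→ₗ[R] R) →ₗ[R] (A [⋀^Fin (q + r)]→ₗ[R] R) :=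
  (TensorProduct.mk R (A [⋀^Fin q]→ₗ[R] R) (A [⋀^Fin r]→ₗ[R] R)).compr₂
    ((AlternatingMap.domDomCongrₗ R finSumFinEquiv).toLinearMap ∘ₗ
      (LinearMap.mul' R R).compAlternatingMapₗ R ∘ₗ AlternatingMap.domCoprod')

theorem wedgeForm_apply {q r : ℕ} (ω : A [⋀^Fin q]→ₗ[R] R) (θ : A [⋀^Fin r]→ₗ[R] R) :
    wedgeForm q r ω θ =
      ((LinearMap.mul' R R).compAlternatingMap (ω.domCoprod θ)).domDomCongr finSumFinEquiv := by
  simp [wedgeForm]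

/-- The wedge product on the exterior algebra. -/
def extWedge : ExtForms R A →ₗ[R] ExtForms R A →ₗ[R] ExtForms R A :=
  DirectSum.toModule R ℕ _ fun q => LinearMap.flip (DirectSum.toModule R ℕ _ fun r =>
    LinearMap.flip ((wedgeForm q r).compr₂
      (DirectSum.lof R ℕ (fun k => A [⋀^Fin k]→ₗ[R] R) (q + r))))

theorem extWedge_of {q r : ℕ} (ω : A [⋀^Fin q]→ₗ[R] R) (θ : A [⋀^Fin r]→ₗ[R] R) :
    extWedge (DirectSum.lof R ℕ (fun k => A [⋀^Fin k]→ₗ[R] R) q ω)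
      (DirectSum.lof R ℕ (fun k => A [⋀^Fin k]→ₗ[R] R) r θ) =
    DirectSum.lof R ℕ (fun k => A [⋀^Fin k]→ₗ[R] R) (q + r) (wedgeForm q r ω θ) := by
  simp [extWedge]

/-- The exterior derivative on the exterior algebra. -/
def GenLieAlgebra.extDiff (L : GenLieAlgebra R A) : ExtForms R A →+ ExtForms R A :=
  DirectSum.toAddMonoid fun q =>
    (DirectSum.of (fun k => A [⋀^Fin k]→ₗ[R] R) (q + 1)).comp
      (AddMonoidHom.mk' L.extDer fun ω θ => AlternatingMap.ext fun z => L.koszul_add ω θ z)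

/-- Two-sided ideals of the exterior algebra. -/
structure IsExtIdeal (I : Submodule R (ExtForms R A)) : Prop where
  wedge_mem_left : ∀ θ, ∀ ω ∈ I, extWedge θ ω ∈ I
  wedge_mem_right : ∀ θ, ∀ ω ∈ I, extWedge ω θ ∈ I

/-- The ideal of the exterior algebra generated by a set. -/
def extIdealSpan (S : Set (ExtForms R A)) : Submodule R (ExtForms R A) :=
  sInf {I | IsExtIdeal I ∧ S ⊆ I}

/-- Ideals of the exterior algebra which are closed under the exterior derivative. -/
structure GenLieAlgebra.IsDifferentialIdeal (L : GenLieAlgebra R A)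
    (I : Submodule R (ExtForms R A)) : Prop where
  isExtIdeal : IsExtIdeal I
  extDiff_mem : ∀ ω ∈ I, L.extDiff ω ∈ I

/-- A linear form on `A`, as an element of degree one of the exterior algebra. -/
def oneForm (θ : Module.Dual R A) : ExtForms R A :=
  DirectSum.of (fun k => A [⋀^Fin k]→ₗ[R] R) 1 (AlternatingMap.ofSubsingleton R A R 0 θ)

end Forms

open scoped Manifold ContDiff Bundle Topology

section Sections

instance pullbackAddCommGroup {B B' : Type*} (f : B' → B) (V : B → Type*)
    [∀ x, AddCommGroup (V x)] (x : B') : AddCommGroup ((f *ᵖ V) x) :=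
  inferInstanceAs (AddCommGroup (V (f x)))

theorem contMDiffAt_pullback_iff {n : ℕ} {B : Type*} [TopologicalSpace B]
    [ChartedSpace (EuclideanSpace ℝ (Fin n)) B] {K : Type*} [NormedAddCommGroup K]
    [NormedSpace ℝ K] {V : B → Type*} [TopologicalSpace (Bundle.TotalSpace K V)]
    [∀ x, TopologicalSpace (V x)] [FiberBundle K V] [∀ x, Zero (V x)]
    {m : ℕ} {B' : Type*} [TopologicalSpace B']
    [ChartedSpace (EuclideanSpace ℝ (Fin m)) B'] (f : C^∞⟮𝓡 m, B'; 𝓡 n, B⟯)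
    (s : ∀ x : B', V (f x)) (x₀ : B') :
    ContMDiffAt (𝓡 m) ((𝓡 m).prod 𝓘(ℝ, K)) ∞
      (fun x => (⟨x, s x⟩ : Bundle.TotalSpace K (f *ᵖ V))) x₀ ↔
    ContMDiffAt (𝓡 m) ((𝓡 n).prod 𝓘(ℝ, K)) ∞
      (fun x => (⟨f x, s x⟩ : Bundle.TotalSpace K V)) x₀ := by
  rw [Bundle.contMDiffAt_totalSpace, Bundle.contMDiffAt_totalSpace]
  exact and_congr ⟨fun _ => f.contMDiff x₀, fun _ => contMDiffAt_id⟩ Iff.rfl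

variable {n : ℕ} {B : Type*} [TopologicalSpace B] [ChartedSpace (EuclideanSpace ℝ (Fin n)) B]
  {K : Type*} [NormedAddCommGroup K] [NormedSpace ℝ K]
  {V : B → Type*} [TopologicalSpace (Bundle.TotalSpace K V)] [∀ x, AddCommGroup (V x)]
  [∀ x, Module ℝ (V x)] [∀ x, TopologicalSpace (V x)] [FiberBundle K V] [VectorBundle ℝ K V]

noncomputable instance sectionSMul : SMul C^∞⟮𝓡 n, B; 𝓘(ℝ, ℝ), ℝ⟯ Cₛ^∞⟮𝓡 n; K, V⟯ where
  smul f s := ⟨fun x => f x • s x, f.contMDiff.smul_section s.contMDiff⟩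

@[simp] theorem section_smul_apply (f : C^∞⟮𝓡 n, B; 𝓘(ℝ, ℝ), ℝ⟯) (s : Cₛ^∞⟮𝓡 n; K, V⟯) (x : B) :
    (f • s) x = f x • s x := rfl

noncomputable instance sectionModule :
    Module C^∞⟮𝓡 n, B; 𝓘(ℝ, ℝ), ℝ⟯ Cₛ^∞⟮𝓡 n; K, V⟯ where
  one_smul s := by ext x; simp
  mul_smul f g s := by ext x; simp [mul_smul]
  smul_zero f := by ext x; simp
  smul_add f s t := by ext x; simp
  add_smul f g s := by ext x; simp [add_smul]
  zero_smul s := by ext x; simp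

variable (n B) in
/-- The inclusion of an open set, whose pull-back `inclMap n B U *ᵖ V` is the restriction of `V` to
`U`. -/
def inclMap (U : TopologicalSpace.Opens B) : C^∞⟮𝓡 n, U; 𝓡 n, B⟯ :=
  ⟨Subtype.val, contMDiff_subtype_val⟩


theorem exists_bump [T2Space B] [IsManifold (𝓡 n) ∞ B] (x : B) {W : Set B} (hW : W ∈ 𝓝 x) :
    ∃ χ : C^∞⟮𝓡 n, B; 𝓘(ℝ, ℝ), ℝ⟯, (∀ᶠ y in 𝓝 x, χ y = 1) ∧ tsupport χ ⊆ W := by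
  obtain ⟨f, -, hf⟩ := (SmoothBumpFunction.nhds_basis_tsupport (I := 𝓡 n) x).mem_iff.1 hW
  exact ⟨⟨f, f.contMDiff⟩, f.eventuallyEq_one, hf⟩

variable [T2Space B] [IsManifold (𝓡 n) ∞ B]

theorem exists_section_of_contMDiffOn [ContMDiffVectorBundle ∞ K V (𝓡 n)] {U : Set B}
    (hU : IsOpen U) (S : ∀ x, V x)
    (hS : ContMDiffOn (𝓡 n) ((𝓡 n).prod 𝓘(ℝ, K)) ∞
      (fun x => (⟨x, S x⟩ : Bundle.TotalSpace K V)) U) {x : B} (hx : x ∈ U) :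
    ∃ T : Cₛ^∞⟮𝓡 n; K, V⟯, ∀ᶠ y in 𝓝 x, T y = S y := by
  obtain ⟨χ, h1, h2⟩ := exists_bump (n := n) x (hU.mem_nhds hx)
  refine ⟨⟨fun y => χ y • S y, ContMDiffOn.smul_section_of_tsupport χ.contMDiff.contMDiffOn hU h2 hS⟩, ?_⟩
  filter_upwards [h1] with y hy
  simp [hy]

theorem exists_section_eq [ContMDiffVectorBundle ∞ K V (𝓡 n)] (x : B) (v : V x) :
    ∃ T : Cₛ^∞⟮𝓡 n; K, V⟯, T x = v := by
  have hmem := FiberBundle.mem_baseSet_trivializationAt' (F := K) (E := V) x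
  obtain ⟨T, hT⟩ := exists_section_of_contMDiffOn (n := n) (K := K) (V := V)
    (trivializationAt K V x).open_baseSet (FiberBundle.extend K v) (by
      intro y hy
      rw [(trivializationAt K V x).contMDiffWithinAt_section _ hy]
      have : ContMDiffOn (𝓡 n) 𝓘(ℝ, K) ∞
          (fun _ : B => (trivializationAt K V x ⟨x, v⟩).2) (trivializationAt K V x).baseSet :=
        contMDiffOn_const
      exact (this.congr fun z hz => by simp [FiberBundle.extend, hz]) y hy) hmem
  exact ⟨T, by simpa using hT.self_of_nhds⟩

theorem exists_extend_section [ContMDiffVectorBundle ∞ K V (𝓡 n)] (U : TopologicalSpace.Opens B)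
    (s : Cₛ^∞⟮𝓡 n; K, inclMap n B U *ᵖ V⟯) (x : U) :
    ∃ T : Cₛ^∞⟮𝓡 n; K, V⟯, ∀ᶠ y in 𝓝 x, T y.1 = s y := by
  classical
  let S : ∀ b, V b := fun b => if hb : b ∈ U then s ⟨b, hb⟩ else 0
  have hS : ∀ y : U, S y.1 = s y := fun y => dif_pos y.2
  obtain ⟨T, hT⟩ := exists_section_of_contMDiffOn (n := n) (K := K) (V := V) U.isOpen S (by
    intro y hy
    refine ContMDiffAt.contMDiffWithinAt ?_
    refine (contMDiffAt_subtype_iff (U := U) (x := ⟨y, hy⟩)).1 ?_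
    have := (contMDiffAt_pullback_iff (inclMap n B U) (fun z : U => s z) ⟨y, hy⟩).1
      (s.contMDiff ⟨y, hy⟩)
    refine this.congr_of_eventuallyEq (Filter.Eventually.of_forall fun z => ?_)
    exact congrArg (Bundle.TotalSpace.mk' K z.1) (hS z)) x.2
  refine ⟨T, ?_⟩
  filter_upwards [continuous_subtype_val.continuousAt.eventually hT] with y hy
  rw [hy, hS]

theorem exists_extend_fun (U : TopologicalSpace.Opens B)
    (f : C^∞⟮𝓡 n, U; 𝓘(ℝ, ℝ), ℝ⟯) (x : U) :
    ∃ g : C^∞⟮𝓡 n, B; 𝓘(ℝ, ℝ), ℝ⟯, ∀ᶠ y in 𝓝 x, g y.1 = f y := by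
  classical
  let S : B → ℝ := fun b => if hb : b ∈ U then f ⟨b, hb⟩ else 0
  have hS : ∀ y : U, S y.1 = f y := fun y => dif_pos y.2
  obtain ⟨χ, h1, h2⟩ := exists_bump (n := n) x.1 (U.isOpen.mem_nhds x.2)
  have hSm : ∀ y ∈ U, ContMDiffAt (𝓡 n) 𝓘(ℝ, ℝ) ∞ S y := by
    intro y hy
    refine (contMDiffAt_subtype_iff (U := U) (x := ⟨y, hy⟩)).1 ?_
    refine (f.contMDiff ⟨y, hy⟩).congr_of_eventuallyEq (Filter.Eventually.of_forall fun z => ?_)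
    exact hS z
  refine ⟨⟨fun y => χ y * S y, ?_⟩, ?_⟩
  · refine contMDiff_of_tsupport fun y hy => ?_
    exact (χ.contMDiff y).mul (hSm y (h2 (tsupport_mul_subset_left hy)))
  · filter_upwards [continuous_subtype_val.continuousAt.eventually h1] with y hy
    simp [hy, hS]

end Sections

theorem eventually_opens_iff {B : Type*} [TopologicalSpace B] (U : TopologicalSpace.Opens B) (x : U) (P : B → Prop) :
    (∀ᶠ y : U in 𝓝 x, P y.1) ↔ ∀ᶠ y in 𝓝 x.1, P y := by
  rw [← U.isOpen.isOpenEmbedding_subtypeVal.map_nhds_eq x]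
  exact Filter.eventually_map.symm

section Restriction

variable {n : ℕ} {B : Type*} [TopologicalSpace B] [ChartedSpace (EuclideanSpace ℝ (Fin n)) B]
  {K : Type*} [NormedAddCommGroup K] [NormedSpace ℝ K]
  {V : B → Type*} [TopologicalSpace (Bundle.TotalSpace K V)] [∀ x, AddCommGroup (V x)]
  [∀ x, Module ℝ (V x)] [∀ x, TopologicalSpace (V x)] [FiberBundle K V] [VectorBundle ℝ K V]
  [T2Space B] [IsManifold (𝓡 n) ∞ B]

namespace GenLieAlgebra

theorem bracket_zero {R A : Type*} [CommRing R] [AddCommGroup A] [Module R A]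
    (L : GenLieAlgebra R A) (u : A) : L.bracket u 0 = 0 := by
  have h := L.bracket_add u 0 0
  rw [add_zero] at h
  exact left_eq_add.1 h

theorem bracket_eq_zero (L : GenLieAlgebra C^∞⟮𝓡 n, B; 𝓘(ℝ, ℝ), ℝ⟯ Cₛ^∞⟮𝓡 n; K, V⟯)
    (S T : Cₛ^∞⟮𝓡 n; K, V⟯) {x : B} (hT : ∀ᶠ y in 𝓝 x, T y = 0) : L.bracket S T x = 0 := by
  obtain ⟨χ, h1, h2⟩ := exists_bump (n := n) x hT
  have h0 : χ • T = 0 := by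
    ext y
    by_cases hy : y ∈ tsupport χ
    · have : T y = 0 := h2 hy
      simp [this]
    · simp [image_eq_zero_of_notMem_tsupport hy]
  have h := L.leibniz S χ T
  rw [h0, L.bracket_zero] at h
  have hx := congrArg (fun s : Cₛ^∞⟮𝓡 n; K, V⟯ => s x) h
  simpa [h1.self_of_nhds, hT.self_of_nhds, eq_comm] using hx

theorem bracket_congr (L : GenLieAlgebra C^∞⟮𝓡 n, B; 𝓘(ℝ, ℝ), ℝ⟯ Cₛ^∞⟮𝓡 n; K, V⟯)
    {S S' T T' : Cₛ^∞⟮𝓡 n; K, V⟯} {x : B} (hS : ∀ᶠ y in 𝓝 x, S y = S' y)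
    (hT : ∀ᶠ y in 𝓝 x, T y = T' y) : L.bracket S T x = L.bracket S' T' x := by
  have aux : ∀ {P Q Q' : Cₛ^∞⟮𝓡 n; K, V⟯}, (∀ᶠ y in 𝓝 x, Q y = Q' y) →
      L.bracket P Q x = L.bracket P Q' x := by
    intro P Q Q' h
    have h0 : L.bracket P (Q - Q') x = 0 :=
      L.bracket_eq_zero P _ (h.mono fun y hy => by simp [hy])
    have h1 : L.bracket P Q = L.bracket P (Q - Q') + L.bracket P Q' := by
      rw [← L.bracket_add, sub_add_cancel]
    simp [h1, h0]
  rw [aux hT, L.bracket_swap S, L.bracket_swap S']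
  simp [aux hS]

theorem anchor_congr (L : GenLieAlgebra C^∞⟮𝓡 n, B; 𝓘(ℝ, ℝ), ℝ⟯ Cₛ^∞⟮𝓡 n; K, V⟯)
    {S S' : Cₛ^∞⟮𝓡 n; K, V⟯} {f f' : C^∞⟮𝓡 n, B; 𝓘(ℝ, ℝ), ℝ⟯} {x : B}
    (hS : ∀ᶠ y in 𝓝 x, S y = S' y) (hf : ∀ᶠ y in 𝓝 x, f y = f' y) :
    L.anchor S f x = L.anchor S' f' x := by
  have h1 : L.anchor (S - S') f x = 0 := by
    obtain ⟨χ, h1, h2⟩ := exists_bump (n := n) x hS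
    have h0 : χ • (S - S') = 0 := by
      ext y
      by_cases hy : y ∈ tsupport χ
      · have : S y = S' y := h2 hy
        simp [this]
      · simp [image_eq_zero_of_notMem_tsupport hy]
    have h := congrArg (fun X => X f x) (congrArg L.anchor h0)
    simpa [-map_sub, h1.self_of_nhds] using h
  have h2 : L.anchor S' (f - f') x = 0 := by
    obtain ⟨χ, h1, h2⟩ := exists_bump (n := n) x hf
    have h0 : χ * (f - f') = 0 := by
      ext y
      by_cases hy : y ∈ tsupport χ
      · have : f y = f' y := h2 hy
        simp [this]
      · simp [image_eq_zero_of_notMem_tsupport hy]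
    have h := congrArg (fun g : C^∞⟮𝓡 n, B; 𝓘(ℝ, ℝ), ℝ⟯ => g x) (congrArg (L.anchor S') h0)
    simpa [-map_sub, h1.self_of_nhds, hf.self_of_nhds] using h
  have e1 : L.anchor S f = L.anchor (S - S') f + L.anchor S' (f - f') + L.anchor S' f' := by
    simp
  simp only [e1, ContMDiffMap.coe_add, Pi.add_apply, h1, h2, zero_add]

end GenLieAlgebra

end Restriction

section Restriction

variable {n : ℕ} {B : Type*} [TopologicalSpace B] [ChartedSpace (EuclideanSpace ℝ (Fin n)) B]
  {K : Type*} [NormedAddCommGroup K] [NormedSpace ℝ K]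
  {V : B → Type*} [TopologicalSpace (Bundle.TotalSpace K V)] [∀ x, AddCommGroup (V x)]
  [∀ x, Module ℝ (V x)] [∀ x, TopologicalSpace (V x)] [FiberBundle K V] [VectorBundle ℝ K V]
  [T2Space B] [IsManifold (𝓡 n) ∞ B] [ContMDiffVectorBundle ∞ K V (𝓡 n)]

/-- A global section with the same germ at `x` as the given section over `U`. -/
noncomputable def extSection (U : TopologicalSpace.Opens B)
    (s : Cₛ^∞⟮𝓡 n; K, inclMap n B U *ᵖ V⟯) (x : U) : Cₛ^∞⟮𝓡 n; K, V⟯ :=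
  Classical.choose (exists_extend_section U s x)

theorem extSection_eventually (U : TopologicalSpace.Opens B)
    (s : Cₛ^∞⟮𝓡 n; K, inclMap n B U *ᵖ V⟯) (x : U) :
    ∀ᶠ y in 𝓝 x, extSection U s x y.1 = s y :=
  Classical.choose_spec (exists_extend_section U s x)

/-- A global function with the same germ at `x` as the given function on `U`. -/
noncomputable def extFun (U : TopologicalSpace.Opens B)
    (f : C^∞⟮𝓡 n, U; 𝓘(ℝ, ℝ), ℝ⟯) (x : U) : C^∞⟮𝓡 n, B; 𝓘(ℝ, ℝ), ℝ⟯ :=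
  Classical.choose (exists_extend_fun U f x)

theorem extFun_eventually (U : TopologicalSpace.Opens B)
    (f : C^∞⟮𝓡 n, U; 𝓘(ℝ, ℝ), ℝ⟯) (x : U) :
    ∀ᶠ y in 𝓝 x, extFun U f x y.1 = f y :=
  Classical.choose_spec (exists_extend_fun U f x)

theorem contMDiff_pullback_of_germs (U : TopologicalSpace.Opens B) (s : ∀ x : U, V x.1)
    (h : ∀ x : U, ∃ T : Cₛ^∞⟮𝓡 n; K, V⟯, ∀ᶠ y in 𝓝 x, T y.1 = s y) :
    ContMDiff (𝓡 n) ((𝓡 n).prod 𝓘(ℝ, K)) ∞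
      (fun x : U => (⟨x, s x⟩ : Bundle.TotalSpace K (inclMap n B U *ᵖ V))) := by
  intro x
  obtain ⟨T, hT⟩ := h x
  refine (contMDiffAt_pullback_iff (inclMap n B U) s x).2 ?_
  have h1 : ContMDiffAt (𝓡 n) ((𝓡 n).prod 𝓘(ℝ, K)) ∞
      (fun y : U => (⟨y.1, T y.1⟩ : Bundle.TotalSpace K V)) x :=
    (T.contMDiff x.1).comp x (contMDiff_subtype_val x)
  refine h1.congr_of_eventuallyEq ?_
  filter_upwards [hT] with y hy
  exact congrArg (Bundle.TotalSpace.mk' K y.1) hy.symm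

theorem contMDiff_of_germs (U : TopologicalSpace.Opens B) (f : U → ℝ)
    (h : ∀ x : U, ∃ g : C^∞⟮𝓡 n, B; 𝓘(ℝ, ℝ), ℝ⟯, ∀ᶠ y in 𝓝 x, g y.1 = f y) :
    ContMDiff (𝓡 n) 𝓘(ℝ, ℝ) ∞ f := by
  intro x
  obtain ⟨g, hg⟩ := h x
  have h1 : ContMDiffAt (𝓡 n) 𝓘(ℝ, ℝ) ∞ (fun y : U => g y.1) x :=
    (g.contMDiff x.1).comp x (contMDiff_subtype_val x)
  exact h1.congr_of_eventuallyEq (hg.mono fun y hy => hy.symm)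

namespace GenLieAlgebra

variable (L : GenLieAlgebra C^∞⟮𝓡 n, B; 𝓘(ℝ, ℝ), ℝ⟯ Cₛ^∞⟮𝓡 n; K, V⟯)
  (U : TopologicalSpace.Opens B)

theorem bracket_congr_opens {S S' T T' : Cₛ^∞⟮𝓡 n; K, V⟯} {x : U}
    (hS : ∀ᶠ y in 𝓝 x, S y.1 = S' y.1) (hT : ∀ᶠ y in 𝓝 x, T y.1 = T' y.1) :
    L.bracket S T x.1 = L.bracket S' T' x.1 :=
  L.bracket_congr ((eventually_opens_iff U x fun y => S y = S' y).1 hS)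
    ((eventually_opens_iff U x fun y => T y = T' y).1 hT)

theorem anchor_congr_opens {S S' : Cₛ^∞⟮𝓡 n; K, V⟯} {f f' : C^∞⟮𝓡 n, B; 𝓘(ℝ, ℝ), ℝ⟯} {x : U}
    (hS : ∀ᶠ y in 𝓝 x, S y.1 = S' y.1) (hf : ∀ᶠ y in 𝓝 x, f y.1 = f' y.1) :
    L.anchor S f x.1 = L.anchor S' f' x.1 :=
  L.anchor_congr ((eventually_opens_iff U x fun y => S y = S' y).1 hS)
    ((eventually_opens_iff U x fun y => f y = f' y).1 hf)

theorem bracket_ext_eventually (s t : Cₛ^∞⟮𝓡 n; K, inclMap n B U *ᵖ V⟯)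
    {S T : Cₛ^∞⟮𝓡 n; K, V⟯} {x : U} (hS : ∀ᶠ y in 𝓝 x, S y.1 = s y)
    (hT : ∀ᶠ y in 𝓝 x, T y.1 = t y) : ∀ᶠ y in 𝓝 x,
      L.bracket S T y.1 = L.bracket (extSection U s y) (extSection U t y) y.1 := by
  filter_upwards [eventually_eventually_nhds.2 hS, eventually_eventually_nhds.2 hT] with y h1 h2
  refine L.bracket_congr_opens U ?_ ?_
  · filter_upwards [h1, extSection_eventually U s y] with z h3 h4
    exact h3.trans h4.symm
  · filter_upwards [h2, extSection_eventually U t y] with z h3 h4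
    exact h3.trans h4.symm

theorem anchor_ext_eventually (s : Cₛ^∞⟮𝓡 n; K, inclMap n B U *ᵖ V⟯)
    (f : C^∞⟮𝓡 n, U; 𝓘(ℝ, ℝ), ℝ⟯) {S : Cₛ^∞⟮𝓡 n; K, V⟯} {g : C^∞⟮𝓡 n, B; 𝓘(ℝ, ℝ), ℝ⟯} {x : U}
    (hS : ∀ᶠ y in 𝓝 x, S y.1 = s y) (hg : ∀ᶠ y in 𝓝 x, g y.1 = f y) : ∀ᶠ y in 𝓝 x,
      L.anchor S g y.1 = L.anchor (extSection U s y) (extFun U f y) y.1 := by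
  filter_upwards [eventually_eventually_nhds.2 hS, eventually_eventually_nhds.2 hg] with y h1 h2
  refine L.anchor_congr_opens U ?_ ?_
  · filter_upwards [h1, extSection_eventually U s y] with z h3 h4
    exact h3.trans h4.symm
  · filter_upwards [h2, extFun_eventually U f y] with z h3 h4
    exact h3.trans h4.symm

/-- The bracket of two sections over `U`, computed at each point from germs. -/
noncomputable def restrictBracket (s t : Cₛ^∞⟮𝓡 n; K, inclMap n B U *ᵖ V⟯) :
    Cₛ^∞⟮𝓡 n; K, inclMap n B U *ᵖ V⟯ :=
  ⟨fun x => L.bracket (extSection U s x) (extSection U t x) x.1,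
    contMDiff_pullback_of_germs U _ fun x => ⟨L.bracket (extSection U s x) (extSection U t x),
      L.bracket_ext_eventually U s t (extSection_eventually U s x) (extSection_eventually U t x)⟩⟩

theorem restrictBracket_eventually (s t : Cₛ^∞⟮𝓡 n; K, inclMap n B U *ᵖ V⟯)
    {S T : Cₛ^∞⟮𝓡 n; K, V⟯} {x : U} (hS : ∀ᶠ y in 𝓝 x, S y.1 = s y)
    (hT : ∀ᶠ y in 𝓝 x, T y.1 = t y) :
    ∀ᶠ y in 𝓝 x, L.bracket S T y.1 = L.restrictBracket U s t y :=
  L.bracket_ext_eventually U s t hS hT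

/-- The derivative of a function on `U` along a section over `U`, computed from germs. -/
noncomputable def restrictAnchorFun (s : Cₛ^∞⟮𝓡 n; K, inclMap n B U *ᵖ V⟯)
    (f : C^∞⟮𝓡 n, U; 𝓘(ℝ, ℝ), ℝ⟯) : C^∞⟮𝓡 n, U; 𝓘(ℝ, ℝ), ℝ⟯ :=
  ⟨fun x => L.anchor (extSection U s x) (extFun U f x) x.1,
    contMDiff_of_germs U _ fun x => ⟨L.anchor (extSection U s x) (extFun U f x),
      L.anchor_ext_eventually U s f (extSection_eventually U s x) (extFun_eventually U f x)⟩⟩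

theorem restrictAnchorFun_eq (s : Cₛ^∞⟮𝓡 n; K, inclMap n B U *ᵖ V⟯)
    (f : C^∞⟮𝓡 n, U; 𝓘(ℝ, ℝ), ℝ⟯) {S : Cₛ^∞⟮𝓡 n; K, V⟯} {g : C^∞⟮𝓡 n, B; 𝓘(ℝ, ℝ), ℝ⟯} {x : U}
    (hS : ∀ᶠ y in 𝓝 x, S y.1 = s y) (hg : ∀ᶠ y in 𝓝 x, g y.1 = f y) :
    L.restrictAnchorFun U s f x = L.anchor S g x.1 :=
  (L.anchor_ext_eventually U s f hS hg).self_of_nhds.symm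

theorem restrictAnchorFun_eventually (s : Cₛ^∞⟮𝓡 n; K, inclMap n B U *ᵖ V⟯)
    (f : C^∞⟮𝓡 n, U; 𝓘(ℝ, ℝ), ℝ⟯) {S : Cₛ^∞⟮𝓡 n; K, V⟯} {g : C^∞⟮𝓡 n, B; 𝓘(ℝ, ℝ), ℝ⟯} {x : U}
    (hS : ∀ᶠ y in 𝓝 x, S y.1 = s y) (hg : ∀ᶠ y in 𝓝 x, g y.1 = f y) :
    ∀ᶠ y in 𝓝 x, L.anchor S g y.1 = L.restrictAnchorFun U s f y :=
  L.anchor_ext_eventually U s f hS hg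

/-- The derivation of `C^∞(U)` attached to a section over `U`. -/
noncomputable def restrictAnchor (s : Cₛ^∞⟮𝓡 n; K, inclMap n B U *ᵖ V⟯) :
    Derivation ℤ C^∞⟮𝓡 n, U; 𝓘(ℝ, ℝ), ℝ⟯ C^∞⟮𝓡 n, U; 𝓘(ℝ, ℝ), ℝ⟯ :=
  Derivation.mk' (AddMonoidHom.mk' (L.restrictAnchorFun U s) (by
    intro f g
    ext x
    have hs := extSection_eventually U s x
    have hf := extFun_eventually U f x
    have hg := extFun_eventually U g x
    have hfg : ∀ᶠ y in 𝓝 x, (extFun U f x + extFun U g x) y.1 = (f + g) y := by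
      filter_upwards [hf, hg] with y h1 h2
      simp [h1, h2]
    rw [L.restrictAnchorFun_eq U s _ hs hfg, ContMDiffMap.coe_add, Pi.add_apply,
      L.restrictAnchorFun_eq U s _ hs hf, L.restrictAnchorFun_eq U s _ hs hg]
    simp)).toIntLinearMap (by
    intro f g
    ext x
    have hs := extSection_eventually U s x
    have hf := extFun_eventually U f x
    have hg := extFun_eventually U g x
    have hfg : ∀ᶠ y in 𝓝 x, (extFun U f x * extFun U g x) y.1 = (f * g) y := by
      filter_upwards [hf, hg] with y h1 h2
      simp [h1, h2]
    have e : L.restrictAnchorFun U s (f * g) x =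
        f x * L.restrictAnchorFun U s g x + g x * L.restrictAnchorFun U s f x := by
      rw [L.restrictAnchorFun_eq U s _ hs hfg, L.restrictAnchorFun_eq U s _ hs hf,
        L.restrictAnchorFun_eq U s _ hs hg]
      simp [hf.self_of_nhds, hg.self_of_nhds]
    exact e)

theorem restrictAnchor_apply (s : Cₛ^∞⟮𝓡 n; K, inclMap n B U *ᵖ V⟯)
    (f : C^∞⟮𝓡 n, U; 𝓘(ℝ, ℝ), ℝ⟯) : L.restrictAnchor U s f = L.restrictAnchorFun U s f := rfl

theorem restrictBracket_eq (s t : Cₛ^∞⟮𝓡 n; K, inclMap n B U *ᵖ V⟯)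
    {S T : Cₛ^∞⟮𝓡 n; K, V⟯} {x : U} (hS : ∀ᶠ y in 𝓝 x, S y.1 = s y)
    (hT : ∀ᶠ y in 𝓝 x, T y.1 = t y) :
    L.restrictBracket U s t x = L.bracket S T x.1 :=
  (L.bracket_ext_eventually U s t hS hT).self_of_nhds.symm

theorem ext_add_eventually {s t : Cₛ^∞⟮𝓡 n; K, inclMap n B U *ᵖ V⟯}
    {S T : Cₛ^∞⟮𝓡 n; K, V⟯} {x : U} (hS : ∀ᶠ y in 𝓝 x, S y.1 = s y)
    (hT : ∀ᶠ y in 𝓝 x, T y.1 = t y) : ∀ᶠ y in 𝓝 x, (S + T) y.1 = (s + t) y := by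
  filter_upwards [hS, hT] with y h1 h2
  exact congrArg₂ (fun a b : V y.1 => a + b) h1 h2

theorem ext_smul_eventually {f : C^∞⟮𝓡 n, U; 𝓘(ℝ, ℝ), ℝ⟯}
    {s : Cₛ^∞⟮𝓡 n; K, inclMap n B U *ᵖ V⟯} {g : C^∞⟮𝓡 n, B; 𝓘(ℝ, ℝ), ℝ⟯}
    {S : Cₛ^∞⟮𝓡 n; K, V⟯} {x : U} (hg : ∀ᶠ y in 𝓝 x, g y.1 = f y)
    (hS : ∀ᶠ y in 𝓝 x, S y.1 = s y) : ∀ᶠ y in 𝓝 x, (g • S) y.1 = (f • s) y := by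
  filter_upwards [hg, hS] with y h1 h2
  exact congrArg₂ (fun (a : ℝ) (b : V y.1) => a • b) h1 h2

/-- The restriction to an open set `U`: the bracket and the anchor at a point of `U` are computed
by replacing sections over `U` and functions on `U` by global ones with the same germ there. -/
noncomputable def restrict : GenLieAlgebra C^∞⟮𝓡 n, U; 𝓘(ℝ, ℝ), ℝ⟯
    Cₛ^∞⟮𝓡 n; K, inclMap n B U *ᵖ V⟯ where
  anchor :=
    { toFun := L.restrictAnchor U
      map_add' := fun s t => by
        ext f x
        have hs := extSection_eventually U s x
        have ht := extSection_eventually U t x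
        have hf := extFun_eventually U f x
        have e : L.restrictAnchorFun U (s + t) f x =
            L.restrictAnchorFun U s f x + L.restrictAnchorFun U t f x := by
          rw [L.restrictAnchorFun_eq U _ _ (ext_add_eventually U hs ht) hf,
            L.restrictAnchorFun_eq U _ _ hs hf, L.restrictAnchorFun_eq U _ _ ht hf]
          simp
        exact e
      map_smul' := fun g s => by
        ext f x
        have hs := extSection_eventually U s x
        have hg := extFun_eventually U g x
        have hf := extFun_eventually U f x
        have e : L.restrictAnchorFun U (g • s) f x = g x * L.restrictAnchorFun U s f x := by
          rw [L.restrictAnchorFun_eq U _ _ (ext_smul_eventually U hg hs) hf,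
            L.restrictAnchorFun_eq U _ _ hs hf]
          simp [hg.self_of_nhds]
        exact e }
  bracket := L.restrictBracket U
  add_bracket u v w := by
    ext x
    have hu := extSection_eventually U u x
    have hv := extSection_eventually U v x
    have hw := extSection_eventually U w x
    have h1 := L.restrictBracket_eq U (u + v) w (ext_add_eventually U hu hv) hw
    rw [L.add_bracket] at h1
    exact h1.trans (congrArg₂ (fun a b : V x.1 => a + b) (L.restrictBracket_eq U u w hu hw).symm
      (L.restrictBracket_eq U v w hv hw).symm)
  bracket_add u v w := by
    ext x
    have hu := extSection_eventually U u x
    have hv := extSection_eventually U v x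
    have hw := extSection_eventually U w x
    have h1 := L.restrictBracket_eq U u (v + w) hu (ext_add_eventually U hv hw)
    rw [L.bracket_add] at h1
    exact h1.trans (congrArg₂ (fun a b : V x.1 => a + b) (L.restrictBracket_eq U u v hu hv).symm
      (L.restrictBracket_eq U u w hu hw).symm)
  bracket_self u := by
    ext x
    have hu := extSection_eventually U u x
    have h1 := L.restrictBracket_eq U u u hu hu
    rw [L.bracket_self] at h1
    exact h1
  jacobi u v w := by
    ext x
    have hu := extSection_eventually U u x
    have hv := extSection_eventually U v x
    have hw := extSection_eventually U w x
    have h1 := L.restrictBracket_eq U u _ hu (L.restrictBracket_eventually U v w hv hw)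
    have h2 := L.restrictBracket_eq U w _ hw (L.restrictBracket_eventually U u v hu hv)
    have h3 := L.restrictBracket_eq U v _ hv (L.restrictBracket_eventually U w u hw hu)
    have h := congrArg (fun s : Cₛ^∞⟮𝓡 n; K, V⟯ => s x.1)
      (L.jacobi (extSection U u x) (extSection U v x) (extSection U w x))
    refine Eq.trans ?_ h
    exact congrArg₂ (fun a b : V x.1 => a + b)
      (congrArg₂ (fun a b : V x.1 => a + b) h1 h2) h3
  leibniz u f v := by
    ext x
    have hu := extSection_eventually U u x
    have hv := extSection_eventually U v x
    have hf := extFun_eventually U f x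
    have h1 := L.restrictBracket_eq U u _ hu (ext_smul_eventually U hf hv)
    rw [L.leibniz] at h1
    refine h1.trans ?_
    refine congrArg₂ (fun a b : V x.1 => a + b)
      (congrArg₂ (fun (a : ℝ) (b : V x.1) => a • b) hf.self_of_nhds
        (L.restrictBracket_eq U u v hu hv).symm)
      (congrArg₂ (fun (a : ℝ) (b : V x.1) => a • b)
        (L.restrictAnchorFun_eq U u f hu hf).symm hv.self_of_nhds)

end GenLieAlgebra

end Restriction

section Algebroid

/-- Two diffeomorphisms `h : M → N`, `η : N → M` and a vector bundle morphism `(ρ, η)` from the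
vector bundle `F` over `N` to the tangent bundle of `M`. -/
structure AnchorDiagram (m n : ℕ) (M N : Type*) [TopologicalSpace M]
    [ChartedSpace (EuclideanSpace ℝ (Fin m)) M] [TopologicalSpace N]
    [ChartedSpace (EuclideanSpace ℝ (Fin n)) N] [IsManifold (𝓡 m) ∞ M]
    (K : Type*) [NormedAddCommGroup K] [NormedSpace ℝ K]
    (F : N → Type*) [TopologicalSpace (Bundle.TotalSpace K F)] [∀ y, AddCommGroup (F y)]
    [∀ y, Module ℝ (F y)] [∀ y, TopologicalSpace (F y)] [FiberBundle K F] where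
  h : M ≃ₘ^∞⟮𝓡 m, 𝓡 n⟯ N
  η : N ≃ₘ^∞⟮𝓡 n, 𝓡 m⟯ M
  ρ : ∀ y : N, F y →ₗ[ℝ] TangentSpace (𝓡 m) (η y)
  contMDiff_ρ : ContMDiff ((𝓡 n).prod 𝓘(ℝ, K)) (𝓡 m).tangent ∞
    (fun v : Bundle.TotalSpace K F => (⟨η v.1, ρ v.1 v.2⟩ : TangentBundle (𝓡 m) M))

variable {m n : ℕ} {M N : Type*} [TopologicalSpace M]
    [ChartedSpace (EuclideanSpace ℝ (Fin m)) M] [TopologicalSpace N]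
    [ChartedSpace (EuclideanSpace ℝ (Fin n)) N] [IsManifold (𝓡 m) ∞ M] [IsManifold (𝓡 n) ∞ N]
    {K : Type*} [NormedAddCommGroup K] [NormedSpace ℝ K]
    {F : N → Type*} [TopologicalSpace (Bundle.TotalSpace K F)] [∀ y, AddCommGroup (F y)]
    [∀ y, Module ℝ (F y)] [∀ y, TopologicalSpace (F y)] [FiberBundle K F] [VectorBundle ℝ K F]

/-- The derivative of a smooth function along a tangent vector. -/
noncomputable def dirDeriv (f : C^∞⟮𝓡 n, N; 𝓘(ℝ, ℝ), ℝ⟯) {z : N} (w : TangentSpace (𝓡 n) z) : ℝ :=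
  mfderiv (𝓡 n) 𝓘(ℝ, ℝ) f z w

theorem dirDeriv_add (f g : C^∞⟮𝓡 n, N; 𝓘(ℝ, ℝ), ℝ⟯) {z : N} (w : TangentSpace (𝓡 n) z) :
    dirDeriv (f + g) w = dirDeriv f w + dirDeriv g w := by
  have hf := (f.contMDiff.mdifferentiable (by simp) z).hasMFDerivAt
  have hg := (g.contMDiff.mdifferentiable (by simp) z).hasMFDerivAt
  exact congrArg (fun D => D w) (hf.add hg).mfderiv

theorem dirDeriv_mul (f g : C^∞⟮𝓡 n, N; 𝓘(ℝ, ℝ), ℝ⟯) {z : N} (w : TangentSpace (𝓡 n) z) :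
    dirDeriv (f * g) w = f z * dirDeriv g w + g z * dirDeriv f w := by
  have hf := (f.contMDiff.mdifferentiable (by simp) z).hasMFDerivAt
  have hg := (g.contMDiff.mdifferentiable (by simp) z).hasMFDerivAt
  exact congrArg (fun D => D w) (hf.mul hg).mfderiv

theorem dirDeriv_vadd (f : C^∞⟮𝓡 n, N; 𝓘(ℝ, ℝ), ℝ⟯) {z : N} (w w' : TangentSpace (𝓡 n) z) :
    dirDeriv f (w + w') = dirDeriv f w + dirDeriv f w' :=
  map_add (mfderiv (𝓡 n) 𝓘(ℝ, ℝ) f z) w w'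

theorem dirDeriv_smul (f : C^∞⟮𝓡 n, N; 𝓘(ℝ, ℝ), ℝ⟯) {z : N} (c : ℝ) (w : TangentSpace (𝓡 n) z) :
    dirDeriv f (c • w) = c * dirDeriv f w :=
  map_smul (mfderiv (𝓡 n) 𝓘(ℝ, ℝ) f z) c w

namespace AnchorDiagram

variable (D : AnchorDiagram m n M N K F)

/-- The vector `Th (ρ v)`, tangent to `N` at the point `h (η y)`, of a vector `v` of the fibre of
`F` over `y`. -/
noncomputable def vec (y : N) (v : F y) : TangentSpace (𝓡 n) (D.h (D.η y)) :=
  mfderiv (𝓡 m) (𝓡 n) D.h (D.η y) (D.ρ y v)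

theorem vec_add (y : N) (v w : F y) : D.vec y (v + w) = D.vec y v + D.vec y w := by
  simp [vec]

theorem vec_smul (y : N) (c : ℝ) (v : F y) : D.vec y (c • v) = c • D.vec y v := by
  simp [vec]

/-- The inverse of the diffeomorphism `h ∘ η` of `N`. -/
noncomputable def back (z : N) : N := D.η.symm (D.h.symm z)

theorem h_η_back (z : N) : D.h (D.η (D.back z)) = z := by
  simp [back]

theorem back_h_η (y : N) : D.back (D.h (D.η y)) = y := by
  simp [back]

/-- The vector field `Γ(Th ∘ ρ, h ∘ η)(u) = (Th ∘ ρ) ∘ u ∘ (h ∘ η)⁻¹` on `N` of a section `u` of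
`F`, applied to the function `f`. -/
noncomputable def act (u : Cₛ^∞⟮𝓡 n; K, F⟯) (f : C^∞⟮𝓡 n, N; 𝓘(ℝ, ℝ), ℝ⟯) :
    C^∞⟮𝓡 n, N; 𝓘(ℝ, ℝ), ℝ⟯ :=
  ⟨fun z => dirDeriv f (D.vec (D.back z) (u (D.back z))), by
    have h1 : ContMDiff (𝓡 n) (𝓡 m).tangent ∞ (fun z => (⟨D.η (D.back z),
        D.ρ (D.back z) (u (D.back z))⟩ : TangentBundle (𝓡 m) M)) :=
      D.contMDiff_ρ.comp (u.contMDiff.comp (D.η.symm.contMDiff.comp D.h.symm.contMDiff))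
    have h2 : ContMDiff (𝓡 m).tangent (𝓡 n).tangent ∞ (tangentMap (𝓡 m) (𝓡 n) D.h) :=
      D.h.contMDiff.contMDiff_tangentMap le_rfl
    have h3 : ContMDiff (𝓡 n).tangent 𝓘(ℝ, ℝ).tangent ∞ (tangentMap (𝓡 n) 𝓘(ℝ, ℝ) f) :=
      f.contMDiff.contMDiff_tangentMap le_rfl
    exact (contMDiff_snd_tangentBundle_modelSpace ℝ 𝓘(ℝ, ℝ)).comp (h3.comp (h2.comp h1))⟩

theorem act_apply (u : Cₛ^∞⟮𝓡 n; K, F⟯) (f : C^∞⟮𝓡 n, N; 𝓘(ℝ, ℝ), ℝ⟯) (z : N) :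
    D.act u f z = dirDeriv f (D.vec (D.back z) (u (D.back z))) := rfl

theorem act_add_left (u v : Cₛ^∞⟮𝓡 n; K, F⟯) (f : C^∞⟮𝓡 n, N; 𝓘(ℝ, ℝ), ℝ⟯) :
    D.act (u + v) f = D.act u f + D.act v f := by
  ext z
  simp [act_apply, vec_add, dirDeriv_vadd]

theorem act_smul_apply (g : C^∞⟮𝓡 n, N; 𝓘(ℝ, ℝ), ℝ⟯) (u : Cₛ^∞⟮𝓡 n; K, F⟯)
    (f : C^∞⟮𝓡 n, N; 𝓘(ℝ, ℝ), ℝ⟯) (z : N) :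
    D.act (g • u) f z = g (D.back z) * D.act u f z := by
  simp [act_apply, vec_smul, dirDeriv_smul]

theorem act_add (u : Cₛ^∞⟮𝓡 n; K, F⟯) (f g : C^∞⟮𝓡 n, N; 𝓘(ℝ, ℝ), ℝ⟯) :
    D.act u (f + g) = D.act u f + D.act u g := by
  ext z
  simp [act_apply, dirDeriv_add]

theorem act_mul (u : Cₛ^∞⟮𝓡 n; K, F⟯) (f g : C^∞⟮𝓡 n, N; 𝓘(ℝ, ℝ), ℝ⟯) :
    D.act u (f * g) = f * D.act u g + g * D.act u f := by
  ext z
  simp [act_apply, dirDeriv_mul, D.h_η_back]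

end AnchorDiagram

/-- A generalized Lie algebroid: the vector bundle `F`, the diffeomorphisms `h` and `η`, the vector
bundle morphism `(ρ, η)`, and a Lie bracket on the sections of `F` satisfying the Leibniz rule with
respect to `Γ(Th ∘ ρ, h ∘ η)`. -/
structure GenLieAlgebroid (m n : ℕ) (M N : Type*) [TopologicalSpace M]
    [ChartedSpace (EuclideanSpace ℝ (Fin m)) M] [TopologicalSpace N]
    [ChartedSpace (EuclideanSpace ℝ (Fin n)) N] [IsManifold (𝓡 m) ∞ M] [IsManifold (𝓡 n) ∞ N]
    (K : Type*) [NormedAddCommGroup K] [NormedSpace ℝ K]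
    (F : N → Type*) [TopologicalSpace (Bundle.TotalSpace K F)] [∀ y, AddCommGroup (F y)]
    [∀ y, Module ℝ (F y)] [∀ y, TopologicalSpace (F y)] [FiberBundle K F] [VectorBundle ℝ K F]
    extends AnchorDiagram m n M N K F where
  bracket : Cₛ^∞⟮𝓡 n; K, F⟯ → Cₛ^∞⟮𝓡 n; K, F⟯ → Cₛ^∞⟮𝓡 n; K, F⟯
  add_bracket : ∀ u v w, bracket (u + v) w = bracket u w + bracket v w
  bracket_add : ∀ u v w, bracket u (v + w) = bracket u v + bracket u w
  bracket_self : ∀ u, bracket u u = 0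
  jacobi : ∀ u v w, bracket u (bracket v w) + bracket w (bracket u v) + bracket v (bracket w u) = 0
  leibniz : ∀ (u : Cₛ^∞⟮𝓡 n; K, F⟯) (f : C^∞⟮𝓡 n, N; 𝓘(ℝ, ℝ), ℝ⟯) (v : Cₛ^∞⟮𝓡 n; K, F⟯),
    bracket u (f • v) = f • bracket u v + toAnchorDiagram.act u f • v

namespace GenLieAlgebroid

variable (𝔉 : GenLieAlgebroid m n M N K F)

theorem bracket_swap (u v : Cₛ^∞⟮𝓡 n; K, F⟯) : 𝔉.bracket u v = -𝔉.bracket v u := by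
  have h := 𝔉.bracket_self (u + v)
  rw [𝔉.add_bracket, 𝔉.bracket_add, 𝔉.bracket_add, 𝔉.bracket_self, 𝔉.bracket_self, zero_add,
    add_zero] at h
  exact eq_neg_of_add_eq_zero_left h

theorem smul_bracket (f : C^∞⟮𝓡 n, N; 𝓘(ℝ, ℝ), ℝ⟯) (u v : Cₛ^∞⟮𝓡 n; K, F⟯) :
    𝔉.bracket (f • u) v = f • 𝔉.bracket u v - 𝔉.act v f • u := by
  rw [𝔉.bracket_swap, 𝔉.leibniz, 𝔉.bracket_swap u v, smul_neg]
  abel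

/-- The anchor is automatically linear over the smooth functions: the two ways of expanding
`[g • u, f • v]` agree. -/
theorem act_smul [T2Space N] [ContMDiffVectorBundle ∞ K F (𝓡 n)]
    (g : C^∞⟮𝓡 n, N; 𝓘(ℝ, ℝ), ℝ⟯) (u : Cₛ^∞⟮𝓡 n; K, F⟯)
    (f : C^∞⟮𝓡 n, N; 𝓘(ℝ, ℝ), ℝ⟯) : 𝔉.act (g • u) f = g * 𝔉.act u f := by
  ext z
  rw [𝔉.act_smul_apply, ContMDiffMap.coe_mul, Pi.mul_apply]
  by_cases hz : 𝔉.back z = z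
  · rw [hz]
  suffices h0 : 𝔉.act u f z = 0 by rw [h0, mul_zero, mul_zero]
  by_cases hv : ∃ v : F z, v ≠ 0
  · obtain ⟨v, hv⟩ := hv
    obtain ⟨T, hT⟩ := exists_section_eq (n := n) (K := K) z v
    obtain ⟨χ, h1, h2⟩ := exists_bump (n := n) (𝔉.back z) (isOpen_ne.mem_nhds hz)
    have hχ1 : χ (𝔉.back z) = 1 := h1.self_of_nhds
    have hχ0 : χ z = 0 := image_eq_zero_of_notMem_tsupport fun hmem => h2 hmem rfl
    have hA : 𝔉.bracket (χ • u) (f • T) =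
        f • (χ • 𝔉.bracket u T - 𝔉.act T χ • u) + 𝔉.act (χ • u) f • T := by
      rw [𝔉.leibniz, 𝔉.smul_bracket]
    have hB : 𝔉.bracket (χ • u) (f • T) =
        χ • (f • 𝔉.bracket u T + 𝔉.act u f • T) - 𝔉.act (f • T) χ • u := by
      rw [𝔉.smul_bracket, 𝔉.leibniz]
    have e := congrArg (fun s : Cₛ^∞⟮𝓡 n; K, F⟯ => s z) (hA.symm.trans hB)
    have hd : 𝔉.act T χ z = 0 := by
      have hloc : χ =ᶠ[𝓝 z] fun _ => (0 : ℝ) :=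
        notMem_tsupport_iff_eventuallyEq.1 fun hmem => h2 hmem rfl
      rw [𝔉.act_apply]
      generalize 𝔉.vec (𝔉.back z) (T (𝔉.back z)) = w
      revert w
      rw [𝔉.h_η_back]
      intro w
      rw [dirDeriv, hloc.mfderiv_eq, mfderiv_const]
      rfl
    have hd' : 𝔉.act (f • T) χ z = 0 := by rw [𝔉.act_smul_apply, hd, mul_zero]
    have e' : 𝔉.act u f z • v = 0 := by
      simpa [hd, hd', hχ0, 𝔉.act_smul_apply, hχ1, hT] using e
    exact (smul_eq_zero.1 e').resolve_right hv
  · push Not at hv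
    have hK : ∀ k : K, k = 0 := by
      intro k
      let c := (trivializationAt K F z).continuousLinearEquivAt ℝ z
        (FiberBundle.mem_baseSet_trivializationAt' z)
      rw [← c.apply_symm_apply k, hv (c.symm k), map_zero]
    have hu : u (𝔉.back z) = 0 := by
      let c := (trivializationAt K F (𝔉.back z)).continuousLinearEquivAt ℝ (𝔉.back z)
        (FiberBundle.mem_baseSet_trivializationAt' _)
      exact c.injective ((hK _).trans (map_zero c).symm)
    rw [𝔉.act_apply, hu]
    have := 𝔉.vec_smul (𝔉.back z) 0 0
    rw [smul_zero, zero_smul] at this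
    rw [this]
    exact map_zero (mfderiv (𝓡 n) 𝓘(ℝ, ℝ) f _)

/-- The generalized Lie algebra of smooth sections of `F` with the anchor
`Γ(Th ∘ ρ, h ∘ η)`. -/
noncomputable def sections [T2Space N] [ContMDiffVectorBundle ∞ K F (𝓡 n)] :
    GenLieAlgebra C^∞⟮𝓡 n, N; 𝓘(ℝ, ℝ), ℝ⟯ Cₛ^∞⟮𝓡 n; K, F⟯ where
  anchor :=
    { toFun := fun u => Derivation.mk' (AddMonoidHom.mk' (𝔉.act u) (𝔉.act_add u)).toIntLinearMap
        (fun f g => 𝔉.act_mul u f g)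
      map_add' := fun u v => Derivation.ext fun f => 𝔉.act_add_left u v f
      map_smul' := fun g u => Derivation.ext fun f => 𝔉.act_smul g u f }
  bracket := 𝔉.bracket
  add_bracket := 𝔉.add_bracket
  bracket_add := 𝔉.bracket_add
  bracket_self := 𝔉.bracket_self
  jacobi := 𝔉.jacobi
  leibniz := 𝔉.leibniz

end GenLieAlgebroid

end Algebroid

section PullBack

variable {m n : ℕ} {M N : Type*} [TopologicalSpace M]
    [ChartedSpace (EuclideanSpace ℝ (Fin m)) M] [TopologicalSpace N]
    [ChartedSpace (EuclideanSpace ℝ (Fin n)) N] [IsManifold (𝓡 m) ∞ M]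
    {K : Type*} [NormedAddCommGroup K] [NormedSpace ℝ K]
    {F : N → Type*} [TopologicalSpace (Bundle.TotalSpace K F)] [∀ y, AddCommGroup (F y)]
    [∀ y, Module ℝ (F y)] [∀ y, TopologicalSpace (F y)] [FiberBundle K F]

namespace AnchorDiagram

/-- The diffeomorphism `h` as a bundled smooth map. -/
noncomputable def hMap (D : AnchorDiagram m n M N K F) : C^∞⟮𝓡 m, M; 𝓡 n, N⟯ :=
  ⟨D.h, D.h.contMDiff⟩

variable [VectorBundle ℝ K F] (D : AnchorDiagram m n M N K F)

/-- The function `f ∘ h` on `M`. -/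
noncomputable def pullFun (f : C^∞⟮𝓡 n, N; 𝓘(ℝ, ℝ), ℝ⟯) : C^∞⟮𝓡 m, M; 𝓘(ℝ, ℝ), ℝ⟯ :=
  ⟨fun x => f (D.h x), f.contMDiff.comp D.h.contMDiff⟩

/-- The function `f ∘ h⁻¹` on `N`. -/
noncomputable def pushFun (f : C^∞⟮𝓡 m, M; 𝓘(ℝ, ℝ), ℝ⟯) : C^∞⟮𝓡 n, N; 𝓘(ℝ, ℝ), ℝ⟯ :=
  ⟨fun y => f (D.h.symm y), f.contMDiff.comp D.h.symm.contMDiff⟩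

@[simp] theorem pullFun_apply (f : C^∞⟮𝓡 n, N; 𝓘(ℝ, ℝ), ℝ⟯) (x : M) :
    D.pullFun f x = f (D.h x) := rfl

@[simp] theorem pushFun_apply (f : C^∞⟮𝓡 m, M; 𝓘(ℝ, ℝ), ℝ⟯) (y : N) :
    D.pushFun f y = f (D.h.symm y) := rfl

/-- The section `u ∘ h` of the pull-back bundle. -/
noncomputable def pull (u : Cₛ^∞⟮𝓡 n; K, F⟯) : Cₛ^∞⟮𝓡 m; K, D.hMap *ᵖ F⟯ :=
  ⟨fun x => u (D.h x), fun x => (contMDiffAt_pullback_iff D.hMap (fun x => u (D.h x)) x).2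
    ((u.contMDiff.comp D.h.contMDiff) x)⟩

/-- The section `s ∘ h⁻¹` of `F` defined by a section of the pull-back bundle. -/
noncomputable def push (s : Cₛ^∞⟮𝓡 m; K, D.hMap *ᵖ F⟯) : Cₛ^∞⟮𝓡 n; K, F⟯ :=
  ⟨fun y => cast (congrArg F (D.h.apply_symm_apply y)) (s (D.h.symm y)), by
    have h1 : ContMDiff (𝓡 m) ((𝓡 n).prod 𝓘(ℝ, K)) ∞
        (fun x => (⟨D.h x, s x⟩ : Bundle.TotalSpace K F)) := fun x =>
      (contMDiffAt_pullback_iff D.hMap (fun x => s x) x).1 (s.contMDiff x)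
    have h2 := h1.comp D.h.symm.contMDiff
    refine h2.congr fun y => ?_
    have h3 : ∀ {a b : N} (hab : a = b) (v : F a),
        (⟨b, cast (congrArg F hab) v⟩ : Bundle.TotalSpace K F) = ⟨a, v⟩ := by
      rintro a b rfl v
      rfl
    exact h3 (D.h.apply_symm_apply y) (s (D.h.symm y))⟩

theorem push_h_apply (s : Cₛ^∞⟮𝓡 m; K, D.hMap *ᵖ F⟯) (x : M) : D.push s (D.h x) = s x := by
  have h : ∀ {a b : M} (hab : a = b) (e : D.h a = D.h b),
      cast (congrArg F e) (s a : F (D.h a)) = s b := by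
    rintro a b rfl e
    rfl
  exact h (D.h.symm_apply_apply x) (D.h.apply_symm_apply _)

theorem ext_h {u v : Cₛ^∞⟮𝓡 n; K, F⟯} (h : ∀ x, u (D.h x) = v (D.h x)) : u = v := by
  ext y
  obtain ⟨x, rfl⟩ := D.h.surjective y
  exact h x

theorem push_pull (u : Cₛ^∞⟮𝓡 n; K, F⟯) : D.push (D.pull u) = u :=
  D.ext_h fun x => D.push_h_apply (D.pull u) x

theorem push_add (s t : Cₛ^∞⟮𝓡 m; K, D.hMap *ᵖ F⟯) :
    D.push (s + t) = D.push s + D.push t :=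
  D.ext_h fun x => (D.push_h_apply (s + t) x).trans
    (congrArg₂ (fun a b : F (D.h x) => a + b) (D.push_h_apply s x) (D.push_h_apply t x)).symm

theorem push_smul (f : C^∞⟮𝓡 m, M; 𝓘(ℝ, ℝ), ℝ⟯) (s : Cₛ^∞⟮𝓡 m; K, D.hMap *ᵖ F⟯) :
    D.push (f • s) = D.pushFun f • D.push s :=
  D.ext_h fun x => (D.push_h_apply (f • s) x).trans
    (congrArg₂ (fun (a : ℝ) (b : F (D.h x)) => a • b)
      (congrArg f (D.h.symm_apply_apply x)) (D.push_h_apply s x)).symm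

theorem pushFun_add (f g : C^∞⟮𝓡 m, M; 𝓘(ℝ, ℝ), ℝ⟯) :
    D.pushFun (f + g) = D.pushFun f + D.pushFun g := rfl

theorem pushFun_mul (f g : C^∞⟮𝓡 m, M; 𝓘(ℝ, ℝ), ℝ⟯) :
    D.pushFun (f * g) = D.pushFun f * D.pushFun g := rfl

theorem pull_push (s : Cₛ^∞⟮𝓡 m; K, D.hMap *ᵖ F⟯) : D.pull (D.push s) = s := by
  ext x
  exact D.push_h_apply s x

theorem pullFun_pushFun (f : C^∞⟮𝓡 m, M; 𝓘(ℝ, ℝ), ℝ⟯) : D.pullFun (D.pushFun f) = f := by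
  ext x
  exact congrArg f (D.h.symm_apply_apply x)

theorem pull_zero : D.pull 0 = 0 := rfl

theorem pull_add (u v : Cₛ^∞⟮𝓡 n; K, F⟯) : D.pull (u + v) = D.pull u + D.pull v := rfl

theorem pull_smul (f : C^∞⟮𝓡 n, N; 𝓘(ℝ, ℝ), ℝ⟯) (u : Cₛ^∞⟮𝓡 n; K, F⟯) :
    D.pull (f • u) = D.pullFun f • D.pull u := rfl

theorem pullFun_add (f g : C^∞⟮𝓡 n, N; 𝓘(ℝ, ℝ), ℝ⟯) :
    D.pullFun (f + g) = D.pullFun f + D.pullFun g := rfl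

theorem pullFun_mul (f g : C^∞⟮𝓡 n, N; 𝓘(ℝ, ℝ), ℝ⟯) :
    D.pullFun (f * g) = D.pullFun f * D.pullFun g := rfl

end AnchorDiagram

namespace GenLieAlgebroid

variable [VectorBundle ℝ K F] [IsManifold (𝓡 n) ∞ N] [T2Space N] [ContMDiffVectorBundle ∞ K F (𝓡 n)]
  (𝔉 : GenLieAlgebroid m n M N K F)

/-- The bracket of the pull-back Lie algebroid, characterized by `[u ∘ h, v ∘ h] = [u, v] ∘ h`. -/
noncomputable def pullBackBracket (s t : Cₛ^∞⟮𝓡 m; K, 𝔉.hMap *ᵖ F⟯) :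
    Cₛ^∞⟮𝓡 m; K, 𝔉.hMap *ᵖ F⟯ :=
  𝔉.pull (𝔉.sections.bracket (𝔉.push s) (𝔉.push t))

/-- The anchor of the pull-back Lie algebroid, characterized by `(u ∘ h)(f ∘ h) = u(f) ∘ h`. -/
noncomputable def pullBackAnchor (s : Cₛ^∞⟮𝓡 m; K, 𝔉.hMap *ᵖ F⟯) :
    Derivation ℤ C^∞⟮𝓡 m, M; 𝓘(ℝ, ℝ), ℝ⟯ C^∞⟮𝓡 m, M; 𝓘(ℝ, ℝ), ℝ⟯ :=
  Derivation.mk' (AddMonoidHom.mk'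
      (fun f => 𝔉.pullFun (𝔉.sections.anchor (𝔉.push s) (𝔉.pushFun f)))
      (fun f g => by rw [𝔉.pushFun_add, map_add, 𝔉.pullFun_add])).toIntLinearMap
    (fun f g => by
      have h : 𝔉.pullFun (𝔉.sections.anchor (𝔉.push s) (𝔉.pushFun (f * g))) =
          f * 𝔉.pullFun (𝔉.sections.anchor (𝔉.push s) (𝔉.pushFun g)) +
          g * 𝔉.pullFun (𝔉.sections.anchor (𝔉.push s) (𝔉.pushFun f)) := by
        rw [𝔉.pushFun_mul, Derivation.leibniz, 𝔉.pullFun_add, smul_eq_mul, smul_eq_mul,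
          𝔉.pullFun_mul, 𝔉.pullFun_mul, 𝔉.pullFun_pushFun, 𝔉.pullFun_pushFun]
      exact h)

theorem pullBackAnchor_apply (s : Cₛ^∞⟮𝓡 m; K, 𝔉.hMap *ᵖ F⟯) (f : C^∞⟮𝓡 m, M; 𝓘(ℝ, ℝ), ℝ⟯) :
    𝔉.pullBackAnchor s f = 𝔉.pullFun (𝔉.sections.anchor (𝔉.push s) (𝔉.pushFun f)) := rfl

/-- The pull-back Lie algebroid, on the bundle `h^*F` over `M`. -/
noncomputable def pullBack : GenLieAlgebra C^∞⟮𝓡 m, M; 𝓘(ℝ, ℝ), ℝ⟯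
    Cₛ^∞⟮𝓡 m; K, 𝔉.hMap *ᵖ F⟯ where
  anchor :=
    { toFun := 𝔉.pullBackAnchor
      map_add' := fun s t => Derivation.ext fun f => by
        rw [Derivation.add_apply, 𝔉.pullBackAnchor_apply, 𝔉.pullBackAnchor_apply,
          𝔉.pullBackAnchor_apply, 𝔉.push_add, map_add, Derivation.add_apply, 𝔉.pullFun_add]
      map_smul' := fun g s => Derivation.ext fun f => by
        rw [RingHom.id_apply, Derivation.smul_apply, 𝔉.pullBackAnchor_apply,
          𝔉.pullBackAnchor_apply, 𝔉.push_smul, map_smul, Derivation.smul_apply, smul_eq_mul,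
          smul_eq_mul, 𝔉.pullFun_mul, 𝔉.pullFun_pushFun] }
  bracket := 𝔉.pullBackBracket
  add_bracket u v w := by
    simp only [pullBackBracket]
    rw [𝔉.push_add, GenLieAlgebra.add_bracket, 𝔉.pull_add]
  bracket_add u v w := by
    simp only [pullBackBracket]
    rw [𝔉.push_add, GenLieAlgebra.bracket_add, 𝔉.pull_add]
  bracket_self u := by
    simp only [pullBackBracket]
    rw [GenLieAlgebra.bracket_self, 𝔉.pull_zero]
  jacobi u v w := by
    simp only [pullBackBracket]
    rw [𝔉.push_pull, 𝔉.push_pull, 𝔉.push_pull, ← 𝔉.pull_add, ← 𝔉.pull_add,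
      GenLieAlgebra.jacobi, 𝔉.pull_zero]
  leibniz u f v := by
    simp only [pullBackBracket]
    change _ = _ + 𝔉.pullBackAnchor u f • v
    rw [𝔉.pullBackAnchor_apply, 𝔉.push_smul, GenLieAlgebra.leibniz, 𝔉.pull_add, 𝔉.pull_smul,
      𝔉.pull_smul, 𝔉.pullFun_pushFun, 𝔉.pull_push]

end GenLieAlgebroid

end PullBack

section Systems

variable {n : ℕ} {B : Type*} [TopologicalSpace B] [ChartedSpace (EuclideanSpace ℝ (Fin n)) B]
  {K : Type*} [NormedAddCommGroup K] [NormedSpace ℝ K]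
  {V : B → Type*} [TopologicalSpace (Bundle.TotalSpace K V)] [∀ x, AddCommGroup (V x)]
  [∀ x, Module ℝ (V x)] [∀ x, TopologicalSpace (V x)] [FiberBundle K V] [VectorBundle ℝ K V]

/-- A smooth vector subbundle: a family of linear subspaces of the fibres which, near every point,
is spanned by finitely many smooth, pointwise linearly independent local sections. -/
structure Subbundle (n : ℕ) {B : Type*} [TopologicalSpace B]
    [ChartedSpace (EuclideanSpace ℝ (Fin n)) B] (K : Type*) [NormedAddCommGroup K]
    [NormedSpace ℝ K] (V : B → Type*) [TopologicalSpace (Bundle.TotalSpace K V)]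
    [∀ x, AddCommGroup (V x)] [∀ x, Module ℝ (V x)] [∀ x, TopologicalSpace (V x)]
    [FiberBundle K V] where
  fiber : ∀ x, Submodule ℝ (V x)
  exists_frame : ∀ x₀ : B, ∃ W : Set B, IsOpen W ∧ x₀ ∈ W ∧ ∃ (r : ℕ) (s : Fin r → ∀ x, V x),
    (∀ i, ContMDiffOn (𝓡 n) ((𝓡 n).prod 𝓘(ℝ, K)) ∞
      (fun x => (⟨x, s i x⟩ : Bundle.TotalSpace K V)) W) ∧
    ∀ x ∈ W, LinearIndependent ℝ (fun i => s i x) ∧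
      Submodule.span ℝ (Set.range fun i => s i x) = fiber x

/-- The module of global smooth sections of a subbundle. -/
noncomputable def Subbundle.sections (E : Subbundle n K V) :
    Submodule C^∞⟮𝓡 n, B; 𝓘(ℝ, ℝ), ℝ⟯ Cₛ^∞⟮𝓡 n; K, V⟯ where
  carrier := {s | ∀ x, s x ∈ E.fiber x}
  add_mem' hs ht x := (E.fiber x).add_mem (hs x) (ht x)
  zero_mem' x := (E.fiber x).zero_mem
  smul_mem' f _ hs x := (E.fiber x).smul_mem (f x) (hs x)

/-- The module of smooth sections of a subbundle over an open set `U`. -/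
noncomputable def Subbundle.sectionsOn (E : Subbundle n K V) (U : TopologicalSpace.Opens B) :
    Submodule C^∞⟮𝓡 n, U; 𝓘(ℝ, ℝ), ℝ⟯ Cₛ^∞⟮𝓡 n; K, inclMap n B U *ᵖ V⟯ where
  carrier := {s | ∀ x : U, (s x : V x.1) ∈ E.fiber x.1}
  add_mem' hs ht x := (E.fiber x.1).add_mem (hs x) (ht x)
  zero_mem' x := (E.fiber x.1).zero_mem
  smul_mem' f _ hs x := (E.fiber x.1).smul_mem (f x) (hs x)

/-- The sections over `U` of the annihilator bundle: the one-forms over `U` which vanish on the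
sections of the subbundle over `U`. -/
noncomputable def Subbundle.annihilatorOn (E : Subbundle n K V) (U : TopologicalSpace.Opens B) :
    Submodule C^∞⟮𝓡 n, U; 𝓘(ℝ, ℝ), ℝ⟯
      (Module.Dual C^∞⟮𝓡 n, U; 𝓘(ℝ, ℝ), ℝ⟯ Cₛ^∞⟮𝓡 n; K, inclMap n B U *ᵖ V⟯) :=
  (E.sectionsOn U).dualAnnihilator

/-- The ideal of the exterior algebra over `U` generated by the sections over `U` of the
annihilator bundle. -/
noncomputable def Subbundle.annihilatorIdealOn (E : Subbundle n K V) (U : TopologicalSpace.Opens B) :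
    Submodule C^∞⟮𝓡 n, U; 𝓘(ℝ, ℝ), ℝ⟯
      (ExtForms C^∞⟮𝓡 n, U; 𝓘(ℝ, ℝ), ℝ⟯ Cₛ^∞⟮𝓡 n; K, inclMap n B U *ᵖ V⟯) :=
  extIdealSpan (oneForm '' (E.annihilatorOn U : Set
    (Module.Dual C^∞⟮𝓡 n, U; 𝓘(ℝ, ℝ), ℝ⟯ Cₛ^∞⟮𝓡 n; K, inclMap n B U *ᵖ V⟯)))

end Systems

section AlgebroidSystems

variable {m n : ℕ} {M N : Type*} [TopologicalSpace M]
    [ChartedSpace (EuclideanSpace ℝ (Fin m)) M] [TopologicalSpace N]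
    [ChartedSpace (EuclideanSpace ℝ (Fin n)) N] [IsManifold (𝓡 m) ∞ M] [IsManifold (𝓡 n) ∞ N]
    {K : Type*} [NormedAddCommGroup K] [NormedSpace ℝ K]
    {F : N → Type*} [TopologicalSpace (Bundle.TotalSpace K F)] [∀ y, AddCommGroup (F y)]
    [∀ y, Module ℝ (F y)] [∀ y, TopologicalSpace (F y)] [FiberBundle K F] [VectorBundle ℝ K F]

/-- An interior differential system of a generalized Lie algebroid: a vector subbundle of the
pull-back bundle `h^*F`. -/
abbrev GenLieAlgebroid.InteriorSystem (𝔉 : GenLieAlgebroid m n M N K F) : Type _ :=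
  Subbundle m K (𝔉.hMap *ᵖ F)

variable [T2Space N] [ContMDiffVectorBundle ∞ K F (𝓡 n)]

/-- An interior differential system is involutive if its sections are closed under the bracket of
the pull-back Lie algebroid. -/
def GenLieAlgebroid.IsInvolutive (𝔉 : GenLieAlgebroid m n M N K F) (E : 𝔉.InteriorSystem) : Prop :=
  ∀ S ∈ E.sections, ∀ T ∈ E.sections, 𝔉.pullBack.bracket S T ∈ E.sections

variable [T2Space M]

/-- An exterior differential system over an open set `U`: a differential ideal `I` of the exterior
algebra of the pull-back Lie algebroid over `U` such that, for some interior differential system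
`E'`, all forms of positive degree in `I` vanish on the sections of `E'` over `U`. -/
def GenLieAlgebroid.IsExteriorSystemOn (𝔉 : GenLieAlgebroid m n M N K F)
    (U : TopologicalSpace.Opens M)
    (I : Submodule C^∞⟮𝓡 m, U; 𝓘(ℝ, ℝ), ℝ⟯
      (ExtForms C^∞⟮𝓡 m, U; 𝓘(ℝ, ℝ), ℝ⟯ Cₛ^∞⟮𝓡 m; K, inclMap m M U *ᵖ (𝔉.hMap *ᵖ F)⟯)) : Prop :=
  (𝔉.pullBack.restrict U).IsDifferentialIdeal I ∧
  ∃ E' : 𝔉.InteriorSystem, ∀ k : ℕ, 1 ≤ k →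
    ∀ θ : Cₛ^∞⟮𝓡 m; K, inclMap m M U *ᵖ (𝔉.hMap *ᵖ F)⟯ [⋀^Fin k]→ₗ[C^∞⟮𝓡 m, U; 𝓘(ℝ, ℝ), ℝ⟯]
      C^∞⟮𝓡 m, U; 𝓘(ℝ, ℝ), ℝ⟯,
    DirectSum.of (fun q => Cₛ^∞⟮𝓡 m; K, inclMap m M U *ᵖ (𝔉.hMap *ᵖ F)⟯
      [⋀^Fin q]→ₗ[C^∞⟮𝓡 m, U; 𝓘(ℝ, ℝ), ℝ⟯] C^∞⟮𝓡 m, U; 𝓘(ℝ, ℝ), ℝ⟯) k θ ∈ I →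
    ∀ u : Fin k → Cₛ^∞⟮𝓡 m; K, inclMap m M U *ᵖ (𝔉.hMap *ᵖ F)⟯,
      (∀ i, u i ∈ E'.sectionsOn U) → θ u = 0

end AlgebroidSystems

/-! ### Forms vanishing on a submodule, and their exterior derivatives -/

section VanishingForms

variable {R A : Type*} [CommRing R] [AddCommGroup A] [Module R A]

/-! The argument is Frobenius' theorem in its dual form, carried out over each chart domain `U` with
the module `𝓔` of sections of `E` over `U`. If `dθ` vanishes on `𝓔` for every one-form `θ`
annihilating `𝓔`, then `dθ(s, t) = s(θ(t)) - t(θ(s)) - θ([s, t])` gives `θ([s, t]) = 0`, so all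
annihilating forms kill `[s, t]`. Conversely, if `𝓔` is closed under the bracket, the formula for
`d` shows that the forms vanishing on `𝓔` are stable under `d`. The two statements match once the
ideal generated by the annihilator is known to be the ideal of all vanishing forms.

That equality (`extIdealSpan_annihilator_eq_vanishingForms`) cannot be read off from an adapted
frame, because `E` need not be trivial over a chart domain. Instead it uses a finite family of
annihilating forms `θ i` and sections `e i` such that `Q = ∑ i, θ i (·) • e i` satisfies `z - Q z ∈
𝓔`; thus `Q` kills `𝓔` and is the identity modulo `𝓔`. Inserting `Q` into one argument at a time,
and summing over the arguments, turns any form `α` into an element of the ideal. This operator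
counts the arguments transverse to `𝓔`: if `α` vanishes as soon as fewer than `j` arguments are
free, it acts on `α` as multiplication by `j`, up to a form which vanishes as soon as fewer than `j
+ 1` are free. As `j ≥ 1` is invertible, an induction (`of_mem_of_vanishing`) puts every vanishing
form into the ideal.

The family comes from a smooth projection onto `E`. Local projections exist by a dual family of a
local frame of `E` (`exists_dual_family`), and the projections onto a fixed subspace form a convex
set, so a partition of unity on `U` glues their matrices (`Subbundle.exists_projection_matrix`,
`Subbundle.exists_complement_forms`).

Involutivity of `E` is a local property, by bump functions (`Subbundle.bracket_mem_sections_iff`),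
so the equivalences over the chart domains combine to the global one. The vanishing condition in the
notion of an exterior differential system is met by `E` itself. -/

/-- The shuffles are classes of permutations without preferred representatives, so the hypothesis is
imposed on every permutation. -/
theorem wedgeForm_eq_zero {q r : ℕ} (α : A [⋀^Fin q]→ₗ[R] R) (θ : A [⋀^Fin r]→ₗ[R] R)
    (z : Fin (q + r) → A)
    (h : ∀ σ : Equiv.Perm (Fin q ⊕ Fin r), (α fun i => z (finSumFinEquiv (σ (Sum.inl i)))) *
      (θ fun i => z (finSumFinEquiv (σ (Sum.inr i)))) = 0) :
    wedgeForm q r α θ z = 0 := by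
  rw [wedgeForm_apply, AlternatingMap.domDomCongr_apply,
    LinearMap.compAlternatingMap_apply, AlternatingMap.domCoprod_apply,
    sum_apply, map_sum]
  refine Finset.sum_eq_zero fun σ _ => ?_
  induction σ using Quotient.inductionOn' with | _ σ
  rw [AlternatingMap.domCoprod.summand_mk'', smul_apply,
    MultilinearMap.domDomCongr_apply, MultilinearMap.domCoprod_apply]
  rcases Int.units_eq_one_or (Equiv.Perm.sign σ) with hs | hs <;> simpa [hs] using h σ

/-- Each shuffle class contains `q! r!` permutations, all contributing the same term. The sum over
the full symmetric group can be reindexed freely, which the sum over classes does not allow. -/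
theorem factorial_smul_wedgeForm {q r : ℕ} (α : A [⋀^Fin q]→ₗ[R] R) (θ : A [⋀^Fin r]→ₗ[R] R)
    (z : Fin (q + r) → A) :
    (q.factorial * r.factorial) • wedgeForm q r α θ z =
      ∑ σ : Equiv.Perm (Fin q ⊕ Fin r), Equiv.Perm.sign σ •
        ((α fun i => z (finSumFinEquiv (σ (Sum.inl i)))) *
          θ fun i => z (finSumFinEquiv (σ (Sum.inr i)))) := by
  have h := congrArg (fun f => LinearMap.mul' R R (f fun i => z (finSumFinEquiv i)))
    (MultilinearMap.domCoprod_alternization_eq α θ)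
  simp only [Fintype.card_fin, MultilinearMap.alternatization_apply, AlternatingMap.smul_apply,
    map_sum, map_nsmul] at h
  rw [wedgeForm_apply, AlternatingMap.domDomCongr_apply, LinearMap.compAlternatingMap_apply]
  refine h.symm.trans (Finset.sum_congr rfl fun σ _ => ?_)
  rcases Int.units_eq_one_or (Equiv.Perm.sign σ) with hs | hs <;> simp [hs]

/-- The forms which vanish on the elements of a submodule, degree by degree. -/
def vanishingForms (𝓔 : Submodule R A) : Submodule R (ExtForms R A) where
  carrier := {α | ∀ (k : ℕ) (u : Fin k → A), (∀ i, u i ∈ 𝓔) → α k u = 0}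
  add_mem' := fun {α θ} hα hθ k u hu => by
    rw [DirectSum.add_apply, AlternatingMap.add_apply, hα k u hu, hθ k u hu, add_zero]
  zero_mem' := fun k u _ => by rw [DirectSum.zero_apply, AlternatingMap.zero_apply]
  smul_mem' := fun c α hα k u hu => by
    rw [DirectSum.smul_apply, AlternatingMap.smul_apply, hα k u hu, smul_zero]

theorem of_mem_vanishingForms {𝓔 : Submodule R A} {k : ℕ} {θ : A [⋀^Fin k]→ₗ[R] R} :
    DirectSum.of (fun q => A [⋀^Fin q]→ₗ[R] R) k θ ∈ vanishingForms 𝓔 ↔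
      ∀ u : Fin k → A, (∀ i, u i ∈ 𝓔) → θ u = 0 := by
  refine ⟨fun h u hu => ?_, fun h l u hu => ?_⟩
  · have := h k u hu
    rwa [DirectSum.of_eq_same] at this
  · rcases eq_or_ne k l with rfl | hkl
    · rw [DirectSum.of_eq_same]
      exact h u hu
    · rw [DirectSum.of_eq_of_ne _ _ _ hkl.symm, AlternatingMap.zero_apply]

theorem mem_of_forall_of_mem {I : Submodule R (ExtForms R A)} {α : ExtForms R A}
    (h : ∀ k, DirectSum.of (fun q => A [⋀^Fin q]→ₗ[R] R) k (α k) ∈ I) : α ∈ I := by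
  classical
  rw [← DirectSum.sum_support_of α]
  exact I.sum_mem fun k _ => h k

theorem extWedge_of_of {q r : ℕ} (α : A [⋀^Fin q]→ₗ[R] R) (θ : A [⋀^Fin r]→ₗ[R] R) :
    extWedge (DirectSum.of (fun k => A [⋀^Fin k]→ₗ[R] R) q α)
      (DirectSum.of (fun k => A [⋀^Fin k]→ₗ[R] R) r θ) =
    DirectSum.of (fun k => A [⋀^Fin k]→ₗ[R] R) (q + r) (wedgeForm q r α θ) :=
  extWedge_of α θ

/-- Every term of a wedge product contains a value of the given vanishing form on some of the
arguments. In degree zero the vanishing condition has no premise, so the component there is `0`;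
this is why the unit is not among the vanishing forms. -/
theorem isExtIdeal_vanishingForms (𝓔 : Submodule R A) : IsExtIdeal (vanishingForms 𝓔) := by
  classical
  constructor
  · intro θ α hα
    rw [← DirectSum.sum_support_of θ, ← DirectSum.sum_support_of α, map_sum]
    refine Submodule.sum_mem _ fun r _ => ?_
    rw [map_sum, LinearMap.sum_apply]
    refine Submodule.sum_mem _ fun q _ => ?_
    rw [extWedge_of_of, of_mem_vanishingForms]
    intro u hu
    refine wedgeForm_eq_zero _ _ _ fun σ => ?_
    rw [hα r _ fun i => hu _, mul_zero]
  · intro θ α hα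
    rw [← DirectSum.sum_support_of θ, ← DirectSum.sum_support_of α, map_sum]
    refine Submodule.sum_mem _ fun r _ => ?_
    rw [map_sum, LinearMap.sum_apply]
    refine Submodule.sum_mem _ fun q _ => ?_
    rw [extWedge_of_of, of_mem_vanishingForms]
    intro u hu
    refine wedgeForm_eq_zero _ _ _ fun σ => ?_
    rw [hα q _ fun i => hu _, zero_mul]

theorem isExtIdeal_extIdealSpan (S : Set (ExtForms R A)) : IsExtIdeal (extIdealSpan S) := by
  constructor
  · intro θ α hα
    refine Submodule.mem_sInf.2 fun I hI => ?_
    exact hI.1.wedge_mem_left θ α (Submodule.mem_sInf.1 hα I hI)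
  · intro θ α hα
    refine Submodule.mem_sInf.2 fun I hI => ?_
    exact hI.1.wedge_mem_right θ α (Submodule.mem_sInf.1 hα I hI)

theorem subset_extIdealSpan (S : Set (ExtForms R A)) : S ⊆ extIdealSpan S :=
  fun _ hα => Submodule.mem_sInf.2 fun _ hI => hI.2 hα

theorem oneForm_mem_vanishingForms {𝓔 : Submodule R A} {θ : Module.Dual R A}
    (hθ : θ ∈ 𝓔.dualAnnihilator) : oneForm θ ∈ vanishingForms 𝓔 := by
  refine of_mem_vanishingForms.2 fun u hu => ?_
  exact (Submodule.mem_dualAnnihilator θ).1 hθ _ (hu 0)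

theorem extIdealSpan_annihilator_le (𝓔 : Submodule R A) :
    extIdealSpan (oneForm '' (𝓔.dualAnnihilator : Set (Module.Dual R A))) ≤ vanishingForms 𝓔 := by
  refine sInf_le ⟨isExtIdeal_vanishingForms 𝓔, ?_⟩
  rintro _ ⟨θ, hθ, rfl⟩
  exact oneForm_mem_vanishingForms hθ

theorem extDiff_of (L : GenLieAlgebra R A) {q : ℕ} (α : A [⋀^Fin q]→ₗ[R] R) :
    L.extDiff (DirectSum.of (fun k => A [⋀^Fin k]→ₗ[R] R) q α) =
      DirectSum.of (fun k => A [⋀^Fin k]→ₗ[R] R) (q + 1) (L.extDer α) := by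
  simp [GenLieAlgebra.extDiff]

/-- On arguments from `𝓔`, the anchor terms differentiate the zero function, and the bracket terms
evaluate the form on elements of `𝓔`, because the bracket stays in `𝓔`. -/
theorem extDiff_mem_vanishingForms (L : GenLieAlgebra R A) {𝓔 : Submodule R A}
    (h𝓔 : ∀ s ∈ 𝓔, ∀ t ∈ 𝓔, L.bracket s t ∈ 𝓔) {α : ExtForms R A} (hα : α ∈ vanishingForms 𝓔) :
    L.extDiff α ∈ vanishingForms 𝓔 := by
  classical
  rw [← DirectSum.sum_support_of α, map_sum]
  refine Submodule.sum_mem _ fun q _ => ?_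
  rw [extDiff_of, of_mem_vanishingForms]
  intro z hz
  have hα' := hα q
  generalize α q = θ at hα'
  change L.koszulAnchor θ z + L.koszulBracket θ z = 0
  have h1 : L.koszulAnchor θ z = 0 := by
    refine Finset.sum_eq_zero fun i _ => ?_
    rw [hα' (i.removeNth z) fun j => hz _, map_zero, mul_zero]
  have h2 : L.koszulBracket θ z = 0 := by
    cases q with
    | zero => rfl
    | succ q =>
      refine Finset.sum_eq_zero fun i _ => Finset.sum_eq_zero fun j _ => ?_
      rw [hα', mul_zero]
      intro k
      refine Fin.cases ?_ (fun k => ?_) k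
      · exact h𝓔 _ (hz _) _ (hz _)
      · exact hz _
  rw [h1, h2, add_zero]

/-- The form `dθ` lies in the ideal, hence vanishes on `(s, t)`; in its formula the terms `s(θ(t))`
and `t(θ(s))` are zero, which leaves `-θ([s, t])`. No complement of `𝓔` is needed here. -/
theorem bracket_of_isDifferentialIdeal (L : GenLieAlgebra R A) {𝓔 : Submodule R A}
    (hI : L.IsDifferentialIdeal
      (extIdealSpan (oneForm '' (𝓔.dualAnnihilator : Set (Module.Dual R A)))))
    {s t : A} (hs : s ∈ 𝓔) (ht : t ∈ 𝓔) {θ : Module.Dual R A} (hθ : θ ∈ 𝓔.dualAnnihilator) :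
    θ (L.bracket s t) = 0 := by
  have h := extIdealSpan_annihilator_le 𝓔
    (hI.extDiff_mem _ (subset_extIdealSpan _ ⟨θ, hθ, rfl⟩))
  rw [oneForm, extDiff_of, of_mem_vanishingForms] at h
  have h' := h ![s, t] (by simp [Fin.forall_fin_two, hs, ht])
  have hs' : θ s = 0 := (Submodule.mem_dualAnnihilator θ).1 hθ s hs
  have ht' : θ t = 0 := (Submodule.mem_dualAnnihilator θ).1 hθ t ht
  change L.koszul _ _ = 0 at h'
  -- The bracket sum of a two-form `dθ` has a single summand, the pair of positions `0 < 1`.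
  have e : (Finset.Ici (0 : Fin 1)) = {0} := by decide
  simpa [GenLieAlgebra.koszul, GenLieAlgebra.koszulAnchor, GenLieAlgebra.koszulBracket,
    Fin.sum_univ_two, Fin.removeNth, hs', ht', e] using h'

end VanishingForms

/-! ### The ideal generated by the annihilator is the ideal of vanishing forms -/

section AnnihilatorIdeal

variable {R A : Type*} [CommRing R] [AddCommGroup A] [Module R A]

/-- For each `j` there are `k!` permutations sending `a` to `j`. -/
theorem sum_perm_apply_eq {X : Type*} [AddCommMonoid X] (k : ℕ) (g : Fin (k + 1) → X)
    (a : Fin (k + 1)) :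
    ∑ σ : Equiv.Perm (Fin (k + 1)), g (σ a) = k.factorial • ∑ j, g j := by
  have h0 : ∑ σ : Equiv.Perm (Fin (k + 1)), g (σ 0) = k.factorial • ∑ j, g j := by
    -- A permutation of `k + 1` letters corresponds to the image of `0` together with a permutation
    -- of `k` letters.
    rw [← Equiv.sum_comp Equiv.Perm.decomposeFin.symm, Fintype.sum_prod_type]
    simp [Finset.smul_sum, Fintype.card_perm]
  rw [← h0, ← Equiv.sum_comp (Equiv.mulRight (Equiv.swap 0 a))]
  simp

/-- Contraction inserts its vector in the first place, whereas `wedgeForm k 1` feeds the last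
argument to the one-form; this rotation passes from one convention to the other. -/
theorem comp_finRotate_symm_eq_cons {X : Type*} {k : ℕ} (z : Fin (k + 1) → X) :
    z ∘ (finRotate (k + 1)).symm =
      Fin.cons (z (Fin.last k)) (fun i : Fin k => z i.castSucc) := by
  funext i
  rw [Function.comp_apply]
  refine Fin.cases ?_ (fun i => ?_) i
  · have : (finRotate (k + 1)).symm 0 = Fin.last k := by
      rw [Equiv.symm_apply_eq, finRotate_last]
    rw [this, Fin.cons_zero]
  · have : (finRotate (k + 1)).symm i.succ = i.castSucc := by
      rw [Equiv.symm_apply_eq, finRotate_apply, Fin.coeSucc_eq_succ]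
    rw [this, Fin.cons_succ]

theorem of_smul {k : ℕ} (c : R) (α : A [⋀^Fin k]→ₗ[R] R) :
    DirectSum.of (fun q => A [⋀^Fin q]→ₗ[R] R) k (c • α) =
      c • DirectSum.of (fun q => A [⋀^Fin q]→ₗ[R] R) k α :=
  map_smul (DirectSum.lof R ℕ (fun q => A [⋀^Fin q]→ₗ[R] R) k) _ _

/-- The wedge product of the contraction of `α` by `e` with a one-form `θ`, up to a sign and a
factorial, is the sum of the substitutions of `θ(·) • e` into the arguments of `α`. -/
theorem factorial_smul_wedgeForm_curryLeft {k : ℕ} (α : A [⋀^Fin (k + 1)]→ₗ[R] R) (e : A)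
    (θ : Module.Dual R A) (z : Fin (k + 1) → A) :
    k.factorial • wedgeForm k 1 (α.curryLeft e) (AlternatingMap.ofSubsingleton R A R 0 θ) z =
      k.factorial • (Equiv.Perm.sign (finRotate (k + 1)) •
        ∑ j, α (Function.update z j (θ (z j) • e))) := by
  have h := factorial_smul_wedgeForm (α.curryLeft e) (AlternatingMap.ofSubsingleton R A R 0 θ) z
  rw [Nat.factorial_one, mul_one] at h
  -- The right-hand sum over positions is spread out over all permutations, a permutation being
  -- assigned the position to which it sends the last letter. Both sides can then be compared term
  -- by term.
  rw [h, smul_comm, ← sum_perm_apply_eq k (fun j => α (Function.update z j (θ (z j) • e)))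
    (Fin.last k), ← Equiv.sum_comp (Equiv.permCongr (finSumFinEquiv (m := k) (n := 1))),
    Finset.smul_sum]
  refine Finset.sum_congr rfl fun σ _ => ?_
  set τ : Equiv.Perm (Fin (k + 1)) := Equiv.permCongr (finSumFinEquiv (m := k) (n := 1)) σ with hτ
  have hsign : Equiv.Perm.sign τ = Equiv.Perm.sign σ := Equiv.Perm.sign_permCongr _ _
  have hl : ∀ i, finSumFinEquiv (σ (Sum.inl i)) = τ i.castSucc := fun i => by
    rw [hτ, Equiv.permCongr_apply]
    congr 2
    exact ((Equiv.symm_apply_eq _).2 rfl).symm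
  have hr : ∀ i, finSumFinEquiv (σ (Sum.inr i)) = τ (Fin.last k) := fun i => by
    rw [hτ, Equiv.permCongr_apply]
    congr 2
    refine ((Equiv.symm_apply_eq _).2 ?_).symm
    rw [Subsingleton.elim i 0]
    rfl
  simp only [hl, hr, AlternatingMap.curryLeft_apply_apply,
    AlternatingMap.ofSubsingleton_apply_apply]
  -- Up to the permutation `τ` and the rotation, the arguments of `α` are those of `z` with `e`
  -- substituted at the position whose entry goes into `θ`. The sign of `τ` will cancel that of `σ`,
  -- so only the sign of the rotation survives.
  have hz : (Matrix.vecCons e fun i : Fin k => z (τ i.castSucc)) =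
      (Function.update z (τ (Fin.last k)) e ∘ τ) ∘ (finRotate (k + 1)).symm := by
    rw [comp_finRotate_symm_eq_cons]
    simp only [Function.comp_apply, Function.update_self]
    refine congrArg (Fin.cons (α := fun _ => A) e) (funext fun i => ?_)
    rw [Function.update_of_ne]
    exact fun h => (Fin.castSucc_lt_last i).ne (τ.injective h)
  rw [hz, AlternatingMap.map_perm, AlternatingMap.map_perm, AlternatingMap.map_update_smul,
    hsign, Equiv.Perm.sign_symm, smul_eq_mul]
  rcases Int.units_eq_one_or (Equiv.Perm.sign σ) with h1 | h1 <;>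
    rcases Int.units_eq_one_or (Equiv.Perm.sign (finRotate (k + 1))) with h2 | h2 <;>
    simp only [h1, h2, one_smul, Units.neg_smul, neg_neg, mul_neg, mul_comm]

variable {ι : Type*} [Fintype ι]

/-- Substituting `∑ i, θ i (·) • e i` into the arguments of `α`, one at a time, yields an element
of any ideal which contains all one-forms `θ i`. -/
theorem exists_substitution_mem {I : Submodule R (ExtForms R A)} (hI : IsExtIdeal I)
    (hR : ∀ k : ℕ, k ≠ 0 → IsUnit (k : R)) (θ : ι → Module.Dual R A) (e : ι → A)
    (hθ : ∀ i, oneForm (θ i) ∈ I) {k : ℕ} (α : A [⋀^Fin (k + 1)]→ₗ[R] R) :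
    ∃ β : A [⋀^Fin (k + 1)]→ₗ[R] R,
      DirectSum.of (fun q => A [⋀^Fin q]→ₗ[R] R) (k + 1) β ∈ I ∧
      ∀ z, β z = ∑ j, α (Function.update z j (∑ i, θ i (z j) • e i)) := by
  -- The scalar compensates the sign of the rotation, whose square is `1`.
  let β : A [⋀^Fin (k + 1)]→ₗ[R] R := ((Equiv.Perm.sign (finRotate (k + 1)) : ℤ) : R) •
    ∑ i, wedgeForm k 1 (α.curryLeft (e i)) (AlternatingMap.ofSubsingleton R A R 0 (θ i))
  refine ⟨β, ?_, fun z => ?_⟩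
  · rw [of_smul, map_sum]
    refine I.smul_mem _ (I.sum_mem fun i _ => ?_)
    rw [← extWedge_of_of]
    exact hI.wedge_mem_left _ _ (hθ i)
  · have hw : ∀ i, wedgeForm k 1 (α.curryLeft (e i))
        (AlternatingMap.ofSubsingleton R A R 0 (θ i)) z =
        ((Equiv.Perm.sign (finRotate (k + 1)) : ℤ) : R) •
          ∑ j, α (Function.update z j (θ i (z j) • e i)) := by
      intro i
      have h := factorial_smul_wedgeForm_curryLeft α (e i) (θ i) z
      rw [nsmul_eq_mul, nsmul_eq_mul] at h
      -- Here the factor `k!` coming from the sum over all permutations is cancelled.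
      rw [(hR _ k.factorial_ne_zero).mul_left_cancel h, Int.cast_smul_eq_zsmul]
      rfl
    have hs : ∀ x : R, ((Equiv.Perm.sign (finRotate (k + 1)) : ℤ) : R) •
        (((Equiv.Perm.sign (finRotate (k + 1)) : ℤ) : R) • x) = x := by
      intro x
      rcases Int.units_eq_one_or (Equiv.Perm.sign (finRotate (k + 1))) with h2 | h2 <;> simp [h2]
    have hsum : ∀ f : ι → A [⋀^Fin (k + 1)]→ₗ[R] R, (∑ i, f i) z = ∑ i, f i z := fun f =>
      map_sum (AddMonoidHom.mk' (fun g : A [⋀^Fin (k + 1)]→ₗ[R] R => g z) fun _ _ => rfl) f _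
    simp only [β, AlternatingMap.smul_apply, hsum, hw, ← Finset.smul_sum, hs]
    rw [Finset.sum_comm]
    refine Finset.sum_congr rfl fun j _ => ?_
    exact (map_sum (α.toMultilinearMap.toLinearMap z j) _ _).symm

/-- The hypothesis on `α` says that `α` vanishes as soon as fewer than `j` of its `k + 1` arguments
are left outside `S`, the arguments in `S` being in `𝓔`. The induction raises `j`, with `d` bounding
the number of steps: modulo the ideal, `j • α` equals a form satisfying the condition for `j + 1`.
-/
theorem of_mem_of_vanishing {𝓔 : Submodule R A} {I : Submodule R (ExtForms R A)}
    (hI : IsExtIdeal I) (hR : ∀ k : ℕ, k ≠ 0 → IsUnit (k : R)) (θ : ι → Module.Dual R A)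
    (e : ι → A) (hθ : ∀ i, oneForm (θ i) ∈ I) (hθ𝓔 : ∀ i, θ i ∈ 𝓔.dualAnnihilator)
    (he : ∀ z, z - ∑ i, θ i z • e i ∈ 𝓔) {k : ℕ} :
    ∀ (d j : ℕ), 0 < j → k + 2 ≤ d + j → ∀ α : A [⋀^Fin (k + 1)]→ₗ[R] R,
    (∀ (S : Finset (Fin (k + 1))) (z : Fin (k + 1) → A), k + 1 < S.card + j →
      (∀ i ∈ S, z i ∈ 𝓔) → α z = 0) →
    DirectSum.of (fun q => A [⋀^Fin q]→ₗ[R] R) (k + 1) α ∈ I := by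
  classical
  intro d
  induction d with
  | zero =>
    intro j _ hj α hα
    -- Now `j` exceeds the number of arguments, so the hypothesis applies with no argument in `𝓔`.
    have : α = 0 := AlternatingMap.ext fun z => hα ∅ z (by simp; omega) (by simp)
    rw [this, map_zero]
    exact I.zero_mem
  | succ d ih =>
    intro j hj0 hj α hα
    obtain ⟨β, hβI, hβ⟩ := exists_substitution_mem hI hR θ e hθ α
    -- Substituting `Q = ∑ i, θ i (·) • e i` gives `0` at an argument in `𝓔`. At any other argument
    -- it changes nothing, because `z l - Q (z l)` is one more argument in `𝓔`. Hence `β z` is `α z`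
    -- times the number of positions outside `S`.
    have key : DirectSum.of (fun q => A [⋀^Fin q]→ₗ[R] R) (k + 1) ((j : R) • α - β) ∈ I := by
      refine ih (j + 1) (Nat.succ_pos j) (by omega) _ fun S z hS hz => ?_
      have h1 : ∀ l ∈ S, α (Function.update z l (∑ i, θ i (z l) • e i)) = 0 := by
        intro l hl
        refine α.map_coord_zero l ?_
        rw [Function.update_self]
        refine Finset.sum_eq_zero fun i _ => ?_
        rw [(Submodule.mem_dualAnnihilator (θ i)).1 (hθ𝓔 i) _ (hz l hl), zero_smul]
      have h2 : ∀ l ∈ Finset.univ \ S,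
          α (Function.update z l (∑ i, θ i (z l) • e i)) = α z := by
        intro l hl
        have hlS : l ∉ S := (Finset.mem_sdiff.1 hl).2
        have h3 : α (Function.update z l (z l - ∑ i, θ i (z l) • e i)) = 0 := by
          refine hα (insert l S) _ ?_ fun i hi => ?_
          · rw [Finset.card_insert_of_notMem hlS]
            omega
          · rcases eq_or_ne i l with rfl | hil
            · rw [Function.update_self]
              exact he _
            · rw [Function.update_of_ne hil]
              exact hz i ((Finset.mem_insert.1 hi).resolve_left hil)
        rw [α.map_update_sub, Function.update_eq_self, sub_eq_zero] at h3
        exact h3.symm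
      rw [AlternatingMap.sub_apply, AlternatingMap.smul_apply, hβ,
        ← Finset.sum_sdiff (Finset.subset_univ S), Finset.sum_eq_zero h1, add_zero,
        Finset.sum_congr rfl h2, Finset.sum_const, nsmul_eq_mul, smul_eq_mul, ← sub_mul]
      -- The condition for `j + 1` adds just one case to that for `j`: exactly `j` positions outside
      -- `S`, where `β z = j • α z`.
      rcases lt_or_ge (k + 1) (S.card + j) with h | h
      · rw [hα S z h hz, mul_zero]
      · have hc : (Finset.univ \ S).card = j := by
          rw [Finset.card_sdiff_of_subset (Finset.subset_univ S), Finset.card_univ, Fintype.card_fin]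
          omega
        rw [hc, sub_self, zero_mul]
    have hsum : DirectSum.of (fun q => A [⋀^Fin q]→ₗ[R] R) (k + 1) ((j : R) • α) ∈ I := by
      have := I.add_mem key hβI
      rwa [← map_add, sub_add_cancel] at this
    obtain ⟨u, hu⟩ := hR j hj0.ne'
    have := I.smul_mem (↑u⁻¹ : R) hsum
    rw [← hu] at this
    rwa [of_smul, smul_smul, Units.inv_mul, one_smul] at this

/-- If finitely many annihilating one-forms cut out a complement of `𝓔`, the ideal
generated by the annihilator of `𝓔` consists of all forms which vanish on `𝓔`. -/
theorem extIdealSpan_annihilator_eq_vanishingForms (hR : ∀ k : ℕ, k ≠ 0 → IsUnit (k : R))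
    {𝓔 : Submodule R A} (θ : ι → Module.Dual R A) (e : ι → A)
    (hθ𝓔 : ∀ i, θ i ∈ 𝓔.dualAnnihilator) (he : ∀ z, z - ∑ i, θ i z • e i ∈ 𝓔) :
    extIdealSpan (oneForm '' (𝓔.dualAnnihilator : Set (Module.Dual R A))) = vanishingForms 𝓔 := by
  refine le_antisymm (extIdealSpan_annihilator_le 𝓔) fun α hα => mem_of_forall_of_mem fun k => ?_
  cases k with
  | zero =>
    -- The empty tuple satisfies the premise vacuously.
    have : α 0 = 0 := AlternatingMap.ext fun u => hα 0 u fun i : Fin 0 => i.elim0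
    rw [this, map_zero]
    exact Submodule.zero_mem _
  | succ k =>
    -- The induction starts at `j = 1`, where the condition only concerns tuples with all entries in
    -- `𝓔`.
    refine of_mem_of_vanishing (isExtIdeal_extIdealSpan _) hR θ e
      (fun i => subset_extIdealSpan _ (Set.mem_image_of_mem oneForm (hθ𝓔 i))) hθ𝓔 he
      (k + 1) 1 one_pos le_rfl _ ?_
    intro S z hS hz
    refine hα (k + 1) z fun i => hz i ?_
    have : S = Finset.univ := by
      rw [← Finset.card_eq_iff_eq_univ, Fintype.card_fin]
      have := S.card_le_univ
      rw [Fintype.card_fin] at this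
      omega
    rw [this]
    exact Finset.mem_univ i

/-- The complement serves both directions: it identifies the generated ideal with the vanishing
forms, and it shows that an element killed by all `θ i` belongs to `𝓔`. -/
theorem isDifferentialIdeal_annihilator_iff (L : GenLieAlgebra R A)
    (hR : ∀ k : ℕ, k ≠ 0 → IsUnit (k : R)) {𝓔 : Submodule R A} (θ : ι → Module.Dual R A)
    (e : ι → A) (hθ𝓔 : ∀ i, θ i ∈ 𝓔.dualAnnihilator) (he : ∀ z, z - ∑ i, θ i z • e i ∈ 𝓔) :
    L.IsDifferentialIdeal
        (extIdealSpan (oneForm '' (𝓔.dualAnnihilator : Set (Module.Dual R A)))) ↔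
      ∀ s ∈ 𝓔, ∀ t ∈ 𝓔, L.bracket s t ∈ 𝓔 := by
  refine ⟨fun h s hs t ht => ?_, fun h => ?_⟩
  · have := he (L.bracket s t)
    rwa [Finset.sum_eq_zero, sub_zero] at this
    intro i _
    rw [bracket_of_isDifferentialIdeal L h hs ht (hθ𝓔 i), zero_smul]
  · rw [extIdealSpan_annihilator_eq_vanishingForms hR θ e hθ𝓔 he]
    exact { isExtIdeal := isExtIdeal_vanishingForms 𝓔
            extDiff_mem := fun α hα => extDiff_mem_vanishingForms L h hα }

end AnnihilatorIdeal

/-! ### Dual families and local projections -/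

section Frames

variable {n : ℕ} {B : Type*} [TopologicalSpace B] [ChartedSpace (EuclideanSpace ℝ (Fin n)) B]
  [IsManifold (𝓡 n) ∞ B]
  {K : Type*} [NormedAddCommGroup K] [NormedSpace ℝ K] [FiniteDimensional ℝ K]
  {V : B → Type*} [TopologicalSpace (Bundle.TotalSpace K V)] [∀ x, AddCommGroup (V x)]
  [∀ x, Module ℝ (V x)] [∀ x, TopologicalSpace (V x)] [FiberBundle K V] [VectorBundle ℝ K V]
  [ContMDiffVectorBundle ∞ K V (𝓡 n)]

/-- Smooth local sections which are linearly independent at a point have a smooth dual family near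
this point. -/
theorem exists_dual_family {r : ℕ} (s : Fin r → ∀ x, V x) (x₀ : B)
    (hs : ∀ i, ∀ᶠ x in 𝓝 x₀, ContMDiffAt (𝓡 n) ((𝓡 n).prod 𝓘(ℝ, K)) ∞
      (fun x => (⟨x, s i x⟩ : Bundle.TotalSpace K V)) x)
    (hli : LinearIndependent ℝ fun i => s i x₀) :
    ∃ l : Fin r → ∀ x, V x →ₗ[ℝ] ℝ, ∀ᶠ x in 𝓝 x₀,
      (∀ i j, l i x (s j x) = if j = i then 1 else 0) ∧
      ∀ (z : ∀ x, V x), ContMDiffAt (𝓡 n) ((𝓡 n).prod 𝓘(ℝ, K)) ∞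
        (fun x => (⟨x, z x⟩ : Bundle.TotalSpace K V)) x →
        ∀ i, ContMDiffAt (𝓡 n) 𝓘(ℝ, ℝ) ∞ (fun y => l i y (z y)) x := by
  set e := trivializationAt K V x₀
  have hx₀ : x₀ ∈ e.baseSet := FiberBundle.mem_baseSet_trivializationAt' x₀
  have hc : ∀ x ∈ e.baseSet, ∀ z : ∀ x, V x, ContMDiffAt (𝓡 n) ((𝓡 n).prod 𝓘(ℝ, K)) ∞
        (fun x => (⟨x, z x⟩ : Bundle.TotalSpace K V)) x →
        ContMDiffAt (𝓡 n) 𝓘(ℝ, K) ∞ (fun y => e.linearMapAt ℝ y (z y)) x := by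
    intro x hx z hz
    refine ((e.contMDiffAt_section_iff hx).1 hz).congr_of_eventuallyEq ?_
    filter_upwards [e.open_baseSet.mem_nhds hx] with y hy
    rw [e.coe_linearMapAt_of_mem hy]
  -- In a trivialization the vectors at `x₀` span an injective image of `ℝ^r`, and `g` is a left
  -- inverse fixed once for all points.
  let T₀ : (Fin r → ℝ) →ₗ[ℝ] K := Fintype.linearCombination ℝ fun i => e.linearMapAt ℝ x₀ (s i x₀)
  have hT₀ : LinearMap.ker T₀ = ⊥ := by
    refine LinearMap.ker_eq_bot.2 ?_
    have : LinearIndependent ℝ fun i => e.linearMapAt ℝ x₀ (s i x₀) := by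
      refine hli.map' (e.linearMapAt ℝ x₀) (LinearMap.ker_eq_bot.2 ?_)
      exact Function.LeftInverse.injective fun v => e.symmₗ_linearMapAt hx₀ v
    exact this.fintypeLinearCombination_injective
  obtain ⟨g, hg⟩ := LinearMap.exists_leftInverse_of_injective T₀ hT₀
  let g' : K →L[ℝ] (Fin r → ℝ) := g.toContinuousLinearMap
  -- The map `G x` sends the standard basis to the images under `g'` of the sections at `x`. It is
  -- the identity at `x₀`, hence invertible nearby, and `(G x)⁻¹ ∘ g'` in the trivialization yields
  -- the dual family. Its smoothness is that of inversion.
  let G : B → (Fin r → ℝ) →L[ℝ] (Fin r → ℝ) := fun x =>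
    ∑ i, (ContinuousLinearMap.proj (R := ℝ) (φ := fun _ : Fin r => ℝ) i).smulRight
      (g' (e.linearMapAt ℝ x (s i x)))
  have hG₀ : G x₀ = 1 := by
    ext1 c
    have h := LinearMap.congr_fun hg c
    simp only [LinearMap.comp_apply, LinearMap.id_apply, T₀, Fintype.linearCombination_apply,
      map_sum, map_smul] at h
    simpa [G, g'] using h
  have hGs : ∀ x j, G x (Pi.single j 1) = g' (e.linearMapAt ℝ x (s j x)) := by
    intro x j
    simp [G, Pi.single_apply]
  have hGsm : ∀ᶠ x in 𝓝 x₀, ContMDiffAt (𝓡 n) 𝓘(ℝ, (Fin r → ℝ) →L[ℝ] (Fin r → ℝ)) ∞ G x := by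
    filter_upwards [Filter.eventually_all.2 hs, e.open_baseSet.mem_nhds hx₀] with x hx hxe
    refine contMDiffAt_finsetSum fun i _ => ?_
    have h1 := hc x hxe (s i) (hx i)
    let Λ : K →L[ℝ] ((Fin r → ℝ) →L[ℝ] (Fin r → ℝ)) :=
      (ContinuousLinearMap.smulRightL ℝ (Fin r → ℝ) (Fin r → ℝ)
        (ContinuousLinearMap.proj (R := ℝ) (φ := fun _ : Fin r => ℝ) i)).comp g'
    exact Λ.contMDiff.contMDiffAt.comp x h1
  have hGu : ∀ᶠ x in 𝓝 x₀, IsUnit (G x) := by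
    have h1 : ContinuousAt G x₀ := hGsm.self_of_nhds.continuousAt
    refine h1.eventually (Units.isOpen.mem_nhds ?_)
    rw [hG₀]
    exact isUnit_one
  refine ⟨fun i x => (LinearMap.proj i).comp
    (((Ring.inverse (G x)).comp g').toLinearMap.comp (e.linearMapAt ℝ x)), ?_⟩
  filter_upwards [hGsm, hGu, e.open_baseSet.mem_nhds hx₀] with x h1 h2 hxe
  refine ⟨fun i j => ?_, fun z hz i => ?_⟩
  · have h3 : Ring.inverse (G x) (G x (Pi.single j 1)) = Pi.single j 1 := by
      rw [← mul_apply_eq_comp, Ring.inverse_mul_cancel _ h2]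
      rfl
    rw [hGs] at h3
    have h4 := congrFun h3 i
    simpa [Pi.single_apply, eq_comm] using h4
  · have h3 : ContMDiffAt (𝓡 n) 𝓘(ℝ, (Fin r → ℝ) →L[ℝ] (Fin r → ℝ)) ∞
        (fun y => Ring.inverse (G y)) x := by
      obtain ⟨u, hu⟩ := h2
      have h5 : ContDiffAt ℝ ∞ Ring.inverse (G x) := by
        rw [← hu]
        exact contDiffAt_ringInverse ℝ u
      exact h5.contMDiffAt.comp x h1
    have h4 : ContMDiffAt (𝓡 n) 𝓘(ℝ, Fin r → ℝ) ∞
        (fun y => g' (e.linearMapAt ℝ y (z y))) x :=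
      g'.contMDiff.contMDiffAt.comp x (hc x hxe z hz)
    have h6 := h3.clm_apply h4
    exact (ContinuousLinearMap.proj (R := ℝ) (φ := fun _ : Fin r => ℝ) i).contMDiff.contMDiffAt.comp
      x h6

/-- The coefficients of a smooth section with respect to a smooth frame are smooth. -/
theorem IsLocalFrameOn.contMDiffAt_coeff_of_isOpen {r : ℕ} {s : Fin r → ∀ x, V x} {U : Set B}
    (hs : IsLocalFrameOn (𝓡 n) K ∞ s U) (hU : IsOpen U) {x : B} (hx : x ∈ U) {z : ∀ x, V x}
    (hz : ContMDiffAt (𝓡 n) ((𝓡 n).prod 𝓘(ℝ, K)) ∞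
      (fun x => (⟨x, z x⟩ : Bundle.TotalSpace K V)) x) (i : Fin r) :
    ContMDiffAt (𝓡 n) 𝓘(ℝ, ℝ) ∞ (fun y => hs.coeff i y (z y)) x := by
  obtain ⟨l, hl⟩ := exists_dual_family s x (fun i => by
    filter_upwards [hU.mem_nhds hx] with y hy
    exact hs.contMDiffAt hU hy i) (hs.linearIndependent hx)
  refine (hl.self_of_nhds.2 z hz i).congr_of_eventuallyEq ?_
  filter_upwards [hl, hU.mem_nhds hx] with y hy hyU
  -- Since `s` is a basis at `y`, a family dual to it is unique.
  have : hs.coeff i y = l i y := by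
    refine (hs.toBasisAt hyU).ext fun j => ?_
    rw [hs.toBasisAt_coe, hy.1 i j, hs.coeff_apply_of_mem hyU (s j), ← hs.toBasisAt_coe hyU j,
      Module.Basis.repr_self, Finsupp.single_apply]
  rw [this]

/-- A subbundle has smooth fibrewise projections near every point. -/
theorem Subbundle.exists_local_projection (E : Subbundle n K V) (x₀ : B) :
    ∃ P : ∀ x, V x →ₗ[ℝ] V x, ∀ᶠ x in 𝓝 x₀,
      (∀ v, P x v ∈ E.fiber x) ∧ (∀ v ∈ E.fiber x, P x v = v) ∧
      ∀ z : ∀ x, V x, ContMDiffAt (𝓡 n) ((𝓡 n).prod 𝓘(ℝ, K)) ∞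
        (fun x => (⟨x, z x⟩ : Bundle.TotalSpace K V)) x →
        ContMDiffAt (𝓡 n) ((𝓡 n).prod 𝓘(ℝ, K)) ∞
          (fun x => (⟨x, P x (z x)⟩ : Bundle.TotalSpace K V)) x := by
  obtain ⟨W, hW, hx₀, r, f, hf, hspan⟩ := E.exists_frame x₀
  have hf' : ∀ x ∈ W, ∀ i, ContMDiffAt (𝓡 n) ((𝓡 n).prod 𝓘(ℝ, K)) ∞
      (fun x => (⟨x, f i x⟩ : Bundle.TotalSpace K V)) x := fun x hx i =>
    (hf i).contMDiffAt (hW.mem_nhds hx)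
  obtain ⟨l, hl⟩ := exists_dual_family f x₀ (fun i => by
    filter_upwards [hW.mem_nhds hx₀] with y hy
    exact hf' y hy i) (hspan x₀ hx₀).1
  -- With `l` dual to the local frame `f` of `E`, the sum of the `l k ⊗ f k` is a projection onto
  -- the fibre of `E`.
  refine ⟨fun x => ∑ k, (l k x).smulRight (f k x), ?_⟩
  filter_upwards [hl, hW.mem_nhds hx₀] with x hx hxW
  refine ⟨fun v => ?_, fun v hv => ?_, fun z hz => ?_⟩
  · rw [LinearMap.sum_apply]
    refine sum_mem fun k _ => ?_
    rw [← (hspan x hxW).2]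
    exact Submodule.smul_mem _ _ (Submodule.subset_span ⟨k, rfl⟩)
  · rw [← (hspan x hxW).2] at hv
    refine LinearMap.eqOn_span (f := ∑ k, (l k x).smulRight (f k x)) (g := LinearMap.id) ?_ hv
    rintro _ ⟨j, rfl⟩
    simp [hx.1]
  · have h : ContMDiffAt (𝓡 n) ((𝓡 n).prod 𝓘(ℝ, K)) ∞
        (fun x => (⟨x, ∑ k, l k x (z x) • f k x⟩ : Bundle.TotalSpace K V)) x :=
      ContMDiffAt.sum_section fun k _ => (hx.2 z hz k).smul_section (hf' x hxW k)
    simpa using h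

end Frames

/-! ### A smooth complement over a chart domain -/

section Complement

variable {n : ℕ} {B : Type*} [TopologicalSpace B] [ChartedSpace (EuclideanSpace ℝ (Fin n)) B]
  [IsManifold (𝓡 n) ∞ B] [T2Space B]
  {K : Type*} [NormedAddCommGroup K] [NormedSpace ℝ K] [FiniteDimensional ℝ K]
  {V : B → Type*} [TopologicalSpace (Bundle.TotalSpace K V)] [∀ x, AddCommGroup (V x)]
  [∀ x, Module ℝ (V x)] [∀ x, TopologicalSpace (V x)] [FiberBundle K V] [VectorBundle ℝ K V]
  [ContMDiffVectorBundle ∞ K V (𝓡 n)]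

theorem IsLocalFrameOn.sum_coeff_smul {p : ℕ} {s : Fin p → ∀ x, V x} {U : Set B}
    (hs : IsLocalFrameOn (𝓡 n) K ∞ s U) {x : B} (hx : x ∈ U) (w : V x) :
    ∑ i, hs.coeff i x w • s i x = w := by
  refine Eq.trans (Finset.sum_congr rfl fun i _ => ?_) ((hs.toBasisAt hx).sum_repr w)
  rw [IsLocalFrameOn.coeff, dif_pos hx, hs.toBasisAt_coe, Module.Basis.coord_apply]

/-- Over an open set with a smooth frame, a subbundle has fibrewise projections with smooth matrix
entries. -/
theorem Subbundle.exists_projection_matrix (E : Subbundle n K V) (U : TopologicalSpace.Opens B)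
    [SigmaCompactSpace U] {p : ℕ} {s : Fin p → ∀ x, V x}
    (hs : IsLocalFrameOn (𝓡 n) K ∞ s (U : Set B)) :
    ∃ (P : ∀ x : U, V x.1 →ₗ[ℝ] V x.1) (a : Fin p → Fin p → C^∞⟮𝓡 n, U; 𝓘(ℝ, ℝ), ℝ⟯),
      ∀ x : U, (∀ v, P x v ∈ E.fiber x.1) ∧ (∀ v ∈ E.fiber x.1, P x v = v) ∧
        ∀ i j, a i j x = hs.coeff i x.1 (P x (s j x.1)) := by
  -- Gluing takes place among functions with values in one fixed vector space, so projections are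
  -- replaced by their matrices in the frame.
  let t : U → Set (Fin p → Fin p → ℝ) := fun x => {a | ∃ P : V x.1 →ₗ[ℝ] V x.1,
    (∀ v, P v ∈ E.fiber x.1) ∧ (∀ v ∈ E.fiber x.1, P v = v) ∧
      ∀ i j, a i j = hs.coeff i x.1 (P (s j x.1))}
  -- Having values in the fibre and fixing it pointwise are both preserved by convex combinations;
  -- only the second needs the weights to add up to `1`.
  have ht : ∀ x, Convex ℝ (t x) := by
    rintro x a ⟨P, hP1, hP2, hP3⟩ b ⟨Q, hQ1, hQ2, hQ3⟩ c d - - hcd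
    refine ⟨c • P + d • Q, fun v => ?_, fun v hv => ?_, fun i j => ?_⟩
    · exact add_mem (Submodule.smul_mem _ _ (hP1 v)) (Submodule.smul_mem _ _ (hQ1 v))
    · rw [LinearMap.add_apply, LinearMap.smul_apply, LinearMap.smul_apply, hP2 v hv, hQ2 v hv,
        ← add_smul, hcd, one_smul]
    · simp [hP3 i j, hQ3 i j]
  obtain ⟨a, ha⟩ := exists_contMDiffMap_forall_mem_convex_of_local (𝓡 n) (n := (⊤ : ℕ∞)) ht (by
    intro x
    obtain ⟨P, hP⟩ := E.exists_local_projection x.1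
    obtain ⟨W, hWP, hW, hxW⟩ := eventually_nhds_iff.1 hP
    refine ⟨Subtype.val ⁻¹' W, (hW.preimage continuous_subtype_val).mem_nhds hxW,
      fun y i j => hs.coeff i y.1 (P y.1 (s j y.1)), fun y hy => ?_, fun y hy => ?_⟩
    · refine ContMDiffAt.contMDiffWithinAt ?_
      refine contMDiffAt_pi_space.2 fun i => contMDiffAt_pi_space.2 fun j => ?_
      have h1 := hs.contMDiffAt_coeff_of_isOpen U.isOpen y.2
        ((hWP y.1 hy).2.2 (s j) (hs.contMDiffAt U.isOpen y.2 j)) i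
      exact h1.comp y (contMDiff_subtype_val y)
    · exact ⟨P y.1, (hWP y.1 hy).1, (hWP y.1 hy).2.1, fun i j => rfl⟩)
  -- Smoothness is recorded by the glued matrix `a`; the projections `P` are then chosen pointwise.
  choose P hP using ha
  refine ⟨P, fun i j => ⟨fun x => a x i j, fun x => ?_⟩, hP⟩
  exact contMDiffAt_pi_space.1 (contMDiffAt_pi_space.1 (a.contMDiff x) i) j

/-- The coefficient functions of the sections over `U` with respect to a frame over `U`. -/
noncomputable def coeffForm (U : TopologicalSpace.Opens B) {p : ℕ} {s : Fin p → ∀ x, V x}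
    (hs : IsLocalFrameOn (𝓡 n) K ∞ s (U : Set B)) (i : Fin p) :
    Module.Dual C^∞⟮𝓡 n, U; 𝓘(ℝ, ℝ), ℝ⟯ Cₛ^∞⟮𝓡 n; K, inclMap n B U *ᵖ V⟯ where
  toFun z := ⟨fun x => hs.coeff i x.1 (z x), fun x => by
    obtain ⟨T, hT⟩ := exists_extend_section U z x
    have h1 : ContMDiffAt (𝓡 n) 𝓘(ℝ, ℝ) ∞ (fun y : U => hs.coeff i y.1 (T y.1)) x :=
      (hs.contMDiffAt_coeff_of_isOpen U.isOpen x.2 (T.contMDiff x.1) i).comp x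
        (contMDiff_subtype_val x)
    refine h1.congr_of_eventuallyEq ?_
    filter_upwards [hT] with y hy
    exact congrArg (hs.coeff i y.1) hy.symm⟩
  map_add' z w := by
    ext x
    exact map_add (hs.coeff i x.1) (z x) (w x)
  map_smul' f z := by
    ext x
    exact map_smul (hs.coeff i x.1) (f x) (z x)

/-- The sections of a frame over `U`. -/
noncomputable def frameSection (U : TopologicalSpace.Opens B) {p : ℕ} {s : Fin p → ∀ x, V x}
    (hs : IsLocalFrameOn (𝓡 n) K ∞ s (U : Set B)) (i : Fin p) :
    Cₛ^∞⟮𝓡 n; K, inclMap n B U *ᵖ V⟯ :=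
  ⟨fun x => s i x.1, fun x => (contMDiffAt_pullback_iff (inclMap n B U) (fun x => s i x.1) x).2
    ((hs.contMDiffAt U.isOpen x.2 i).comp x (contMDiff_subtype_val x))⟩

/-- The form `θ i` is the `i`-th coefficient of `z - P z`, for a smooth projection `P` onto `E`.
There are as many forms as the rank `p` of the ambient bundle, so they are dependent in general;
this avoids a frame of the annihilator, which need not exist over `U`. -/
theorem Subbundle.exists_complement_forms (E : Subbundle n K V) (U : TopologicalSpace.Opens B)
    [SigmaCompactSpace U] {p : ℕ} {s : Fin p → ∀ x, V x}
    (hs : IsLocalFrameOn (𝓡 n) K ∞ s (U : Set B)) :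
    ∃ θ : Fin p → Module.Dual C^∞⟮𝓡 n, U; 𝓘(ℝ, ℝ), ℝ⟯ Cₛ^∞⟮𝓡 n; K, inclMap n B U *ᵖ V⟯,
      (∀ i, θ i ∈ E.annihilatorOn U) ∧
      ∀ z, z - ∑ i, θ i z • frameSection U hs i ∈ E.sectionsOn U := by
  obtain ⟨P, a, hP⟩ := E.exists_projection_matrix U hs
  let Q : ∀ x : U, V x.1 →ₗ[ℝ] V x.1 := fun x => LinearMap.id - P x
  have hQ : ∀ (x : U) (v : V x.1), Q x v = v - P x v := fun x v => rfl
  let θ : Fin p → Module.Dual C^∞⟮𝓡 n, U; 𝓘(ℝ, ℝ), ℝ⟯ Cₛ^∞⟮𝓡 n; K, inclMap n B U *ᵖ V⟯ :=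
    fun i => coeffForm U hs i - ∑ j, a i j • coeffForm U hs j
  have hθ : ∀ i z (x : U), θ i z x = hs.coeff i x.1 (Q x (z x)) := by
    intro i z x
    have h1 : (θ i z) x = hs.coeff i x.1 (z x) - ∑ j, a i j x * hs.coeff j x.1 (z x) := by
      have h2 : ∀ S : Finset (Fin p), (∑ j ∈ S, a i j • coeffForm U hs j) z x =
          ∑ j ∈ S, a i j x * hs.coeff j x.1 (z x) := by
        intro S
        induction S using Finset.cons_induction with
        | empty => rfl
        | cons j S hj ih =>
          rw [Finset.sum_cons, Finset.sum_cons, ← ih]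
          rfl
      rw [← h2]
      rfl
    have h4 : hs.coeff i x.1 (P x (z x)) = ∑ j, a i j x * hs.coeff j x.1 (z x) := by
      -- Expanding the argument in the frame expresses `P` by its matrix `a`.
      conv_lhs => rw [← hs.sum_coeff_smul x.2 (z x)]
      simp only [map_sum, map_smul, smul_eq_mul]
      exact Finset.sum_congr rfl fun j _ => by rw [(hP x).2.2 i j, mul_comm]
    rw [h1, ← h4]
    exact (map_sub (hs.coeff i x.1) _ _).symm
  refine ⟨θ, fun i => (Submodule.mem_dualAnnihilator _).2 fun z hz => ?_, fun z x => ?_⟩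
  · ext x
    have h0 : ∀ v ∈ E.fiber x.1, Q x v = 0 := fun v hv => by rw [hQ, (hP x).2.1 v hv, sub_self]
    rw [hθ]
    exact (congrArg (hs.coeff i x.1) (h0 _ (hz x))).trans (map_zero _)
  · have h2 : ∀ S : Finset (Fin p), (∑ i ∈ S, θ i z • frameSection U hs i) x =
        ∑ i ∈ S, hs.coeff i x.1 (Q x (z x)) • s i x.1 := by
      intro S
      induction S using Finset.cons_induction with
      | empty => rfl
      | cons i S hi ih =>
        rw [Finset.sum_cons, Finset.sum_cons, ← ih, ← hθ]
        rfl
    have h4 : (z - ∑ i, θ i z • frameSection U hs i) x = P x (z x) := by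
      refine Eq.trans (b := (z x : V x.1) - (∑ i, θ i z • frameSection U hs i) x) rfl ?_
      rw [h2, hs.sum_coeff_smul x.2]
      exact sub_sub_cancel _ _
    rw [h4]
    exact (hP x).1 _

end Complement

/-! ### Locality of involutivity, and the theorem -/

section Involutive

variable {n : ℕ} {B : Type*} [TopologicalSpace B] [ChartedSpace (EuclideanSpace ℝ (Fin n)) B]
  [IsManifold (𝓡 n) ∞ B] [T2Space B]
  {K : Type*} [NormedAddCommGroup K] [NormedSpace ℝ K]
  {V : B → Type*} [TopologicalSpace (Bundle.TotalSpace K V)] [∀ x, AddCommGroup (V x)]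
  [∀ x, Module ℝ (V x)] [∀ x, TopologicalSpace (V x)] [FiberBundle K V] [VectorBundle ℝ K V]
  [ContMDiffVectorBundle ∞ K V (𝓡 n)]

/-- The restriction of a global section to an open set. -/
noncomputable def restrictSection (U : TopologicalSpace.Opens B) (S : Cₛ^∞⟮𝓡 n; K, V⟯) :
    Cₛ^∞⟮𝓡 n; K, inclMap n B U *ᵖ V⟯ :=
  ⟨fun x => S x.1, contMDiff_pullback_of_germs U _ fun _ =>
    ⟨S, Filter.Eventually.of_forall fun _ => rfl⟩⟩

/-- An arbitrary global extension lies in `E` only near `x`; a bump function supported in that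
neighbourhood makes it a section of `E` everywhere without changing its germ at `x`. -/
theorem Subbundle.exists_extend_section_mem (E : Subbundle n K V) (U : TopologicalSpace.Opens B)
    {s : Cₛ^∞⟮𝓡 n; K, inclMap n B U *ᵖ V⟯} (hs : s ∈ E.sectionsOn U) (x : U) :
    ∃ T ∈ E.sections, ∀ᶠ y in 𝓝 x, T y.1 = s y := by
  obtain ⟨T, hT⟩ := exists_extend_section U s x
  have hE : ∀ᶠ y in 𝓝 x.1, T y ∈ E.fiber y := by
    refine (eventually_opens_iff U x fun y => T y ∈ E.fiber y).1 ?_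
    filter_upwards [hT] with y hy
    rw [hy]
    exact hs y
  obtain ⟨χ, h1, h2⟩ := exists_bump (n := n) x.1 hE
  refine ⟨χ • T, fun y => ?_, ?_⟩
  · rw [section_smul_apply]
    by_cases hy : y ∈ tsupport χ
    · exact Submodule.smul_mem _ _ (h2 hy)
    · rw [image_eq_zero_of_notMem_tsupport hy, zero_smul]
      exact Submodule.zero_mem _
  · filter_upwards [hT, (eventually_opens_iff U x fun y => χ y = 1).2 h1] with y hy hy1
    rw [section_smul_apply, hy1, one_smul, hy]

/-- Closedness of the sections of a subbundle under a bracket can be tested on an open cover. -/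
theorem Subbundle.bracket_mem_sections_iff (E : Subbundle n K V)
    (L : GenLieAlgebra C^∞⟮𝓡 n, B; 𝓘(ℝ, ℝ), ℝ⟯ Cₛ^∞⟮𝓡 n; K, V⟯)
    {𝒰 : Set (TopologicalSpace.Opens B)} (h𝒰 : ∀ x, ∃ U ∈ 𝒰, x ∈ U) :
    (∀ S ∈ E.sections, ∀ T ∈ E.sections, L.bracket S T ∈ E.sections) ↔
      ∀ U ∈ 𝒰, ∀ s ∈ E.sectionsOn U, ∀ t ∈ E.sectionsOn U,
        (L.restrict U).bracket s t ∈ E.sectionsOn U := by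
  refine ⟨fun h U _ s hs t ht x => ?_, fun h S hS T hT x => ?_⟩
  · obtain ⟨S, hS, hSs⟩ := E.exists_extend_section_mem U hs x
    obtain ⟨T, hT, hTt⟩ := E.exists_extend_section_mem U ht x
    have e := L.restrictBracket_eq U s t hSs hTt
    change L.restrictBracket U s t x ∈ E.fiber x.1
    rw [e]
    exact h S hS T hT x.1
  · obtain ⟨U, hU, hx⟩ := h𝒰 x
    -- The global sections themselves represent the germs of their restrictions, so the local
    -- bracket has the value of the global one.
    have e := L.restrictBracket_eq U (restrictSection U S) (restrictSection U T) (S := S) (T := T)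
      (x := ⟨x, hx⟩) (Filter.Eventually.of_forall fun _ => rfl)
      (Filter.Eventually.of_forall fun _ => rfl)
    have h1 := h U hU (restrictSection U S) (fun y => hS y.1) (restrictSection U T)
      (fun y => hT y.1) ⟨x, hx⟩
    change L.restrictBracket U _ _ ⟨x, hx⟩ ∈ E.fiber x at h1
    rw [e] at h1
    exact h1

theorem isUnit_natCast_smoothFunction {k : ℕ} (hk : k ≠ 0) :
    IsUnit (k : C^∞⟮𝓡 n, B; 𝓘(ℝ, ℝ), ℝ⟯) := by
  have h : IsUnit (k : ℝ) := (Nat.cast_ne_zero.2 hk).isUnit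
  have := h.map (algebraMap ℝ C^∞⟮𝓡 n, B; 𝓘(ℝ, ℝ), ℝ⟯)
  rwa [map_natCast] at this

/-- A paracompact manifold may have uncountably many components, but a chart domain is homeomorphic
to an open subset of a Euclidean space. This provides the countability needed for partitions of
unity on it. -/
theorem OpenPartialHomeomorph.sigmaCompactSpace_source {X Y : Type*} [TopologicalSpace X]
    [TopologicalSpace Y] [LocallyCompactSpace Y] [SecondCountableTopology Y]
    (ξ : OpenPartialHomeomorph X Y) : SigmaCompactSpace ξ.source := by
  have : LocallyCompactSpace ξ.target := ξ.open_target.locallyCompactSpace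
  exact ξ.toHomeomorphSourceTarget.isClosedEmbedding.sigmaCompactSpace

end Involutive

theorem mainTheorem10 (m n p : ℕ) (M N : Type*)
    [TopologicalSpace M] [T2Space M] [ParacompactSpace M]
    [ChartedSpace (EuclideanSpace ℝ (Fin m)) M] [IsManifold (𝓡 m) ∞ M]
    [TopologicalSpace N] [T2Space N] [ParacompactSpace N]
    [ChartedSpace (EuclideanSpace ℝ (Fin n)) N] [IsManifold (𝓡 n) ∞ N]
    (F : N → Type*) [TopologicalSpace (Bundle.TotalSpace (EuclideanSpace ℝ (Fin p)) F)]
    [∀ y, AddCommGroup (F y)] [∀ y, Module ℝ (F y)] [∀ y, TopologicalSpace (F y)]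
    [FiberBundle (EuclideanSpace ℝ (Fin p)) F] [VectorBundle ℝ (EuclideanSpace ℝ (Fin p)) F]
    [ContMDiffVectorBundle ∞ (EuclideanSpace ℝ (Fin p)) F (𝓡 n)]
    (𝔉 : GenLieAlgebroid m n M N (EuclideanSpace ℝ (Fin p)) F)
    (E : 𝔉.InteriorSystem)
    (𝒜 : Set (OpenPartialHomeomorph M (EuclideanSpace ℝ (Fin m))))
    (h𝒜 : 𝒜 ⊆ IsManifold.maximalAtlas (𝓡 m) ∞ M)
    (hcover : ∀ x : M, ∃ ξ ∈ 𝒜, x ∈ ξ.source)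
    (htriv : ∀ ξ ∈ 𝒜, ∃ s : Fin p → ∀ x : M, (𝔉.hMap *ᵖ F) x,
      IsLocalFrameOn (𝓡 m) (EuclideanSpace ℝ (Fin p)) ∞ s ξ.source) :
    𝔉.IsInvolutive E ↔
      ∀ ξ ∈ 𝒜, 𝔉.IsExteriorSystemOn ⟨ξ.source, ξ.open_source⟩
        (E.annihilatorIdealOn ⟨ξ.source, ξ.open_source⟩) := by
  have hiff : 𝔉.IsInvolutive E ↔ ∀ U ∈ (fun ξ : OpenPartialHomeomorph M
      (EuclideanSpace ℝ (Fin m)) => (⟨ξ.source, ξ.open_source⟩ : TopologicalSpace.Opens M)) '' 𝒜,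
      ∀ s ∈ E.sectionsOn U, ∀ t ∈ E.sectionsOn U,
        (𝔉.pullBack.restrict U).bracket s t ∈ E.sectionsOn U := by
    refine E.bracket_mem_sections_iff 𝔉.pullBack fun x => ?_
    obtain ⟨ξ, hξ, hx⟩ := hcover x
    exact ⟨_, Set.mem_image_of_mem _ hξ, hx⟩
  rw [hiff, Set.forall_mem_image]
  -- From here on a single chart is fixed, and involutivity over its domain is compared with the
  -- condition on the ideal there.
  refine forall₂_congr fun ξ hξ => ?_
  obtain ⟨s, hs⟩ := htriv ξ hξ
  have : SigmaCompactSpace (⟨ξ.source, ξ.open_source⟩ : TopologicalSpace.Opens M) :=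
    ξ.sigmaCompactSpace_source
  obtain ⟨θ, hθ, hθE⟩ := E.exists_complement_forms ⟨ξ.source, ξ.open_source⟩ hs
  -- The system `E'` is taken to be `E`, since the ideal generated by the annihilator vanishes on
  -- the sections of `E`.
  refine (isDifferentialIdeal_annihilator_iff (𝔉.pullBack.restrict ⟨ξ.source, ξ.open_source⟩)
    (fun k hk => isUnit_natCast_smoothFunction hk) θ _ hθ hθE).symm.trans
    ⟨fun h => ⟨h, E, fun k _ α hα u hu => ?_⟩, fun h => h.1⟩
  exact of_mem_vanishingForms.1 (extIdealSpan_annihilator_le _ hα) u hu
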